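/- **Conventions.** Everything is PL. $h^g=g^{-1}hg$, $[g,h]=g^{-1}h^{-1}gh$, and multiple commutators are left-normed. An $m$-component link is a PL embedding $L\colon mS^1=S^1_1\sqcup\dots\sqcup S^1_m\hookrightarrow S^3$; $\pi=\pi(L)=\pi_1(S^3\setminus L(mS^1))$, $\pi''$ is its second derived subgroup, and $M\subset\pi$ is the set of all meridians of all components. For a group $G$ and $a\in G$ put $\langle a\rangle_0^G=G$, and let $\langle a\rangle_{j+1}^G$ be the normal closure of $a$ in $\langle a\rangle_j^G$. For $k\ge 0$ let $$\mu_k=\big\langle [a,a^g]\ :\ a\in M,\ g\in\langle a\rangle_k^{\pi}\big\rangle,\qquad \delta_k=\big\langle [g,\underbrace{a,\dots,a}_{k+2}]\ :\ a\in M,\ g\in\pi\big\rangle .$$ **Crossing changes.** A PL map $f\colon mS^1\to S^3$ with a single double point $f(p)=f(q)$ is a *$k$-quasi-embedding* if $p,q$ lie in one component $S^1_i$ and, with $P_0=\{f(p)\}$, there are compact polyhedra $P_1\subset\dots\subset P_k\subset S^3\setminus\bigcup_{j\ne i}f(S^1_j)$ and arcs $J_0\subset\dots\subset J_{k-1}\subset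 S^1_i$ such that for $0\le j<k$ one has $f^{-1}(P_j)\subset J_j$, $f(J_j)\subset P_{j+1}$, and the inclusion $P_j\cup f(J_j)\subset P_{j+1}$ is null-homotopic. A self-crossing change $L_0\leftrightarrow L_1$ with intermediate singular link $L_s$ is *allowed in a $k$-quasi-isotopy* if $L_s$ is a $k$-quasi-embedding. An *elementary $k$-move* on $L$ is the interior connected sum of $L$ with the $k$-th Milnor curve $C$ in a solid torus $T\subset S^3\setminus L(mS^1)$ (the second component of the $(k+1)$-st Milnor link in the exterior $T$ of its unknotted first component), along a band which joins $C$ to $L$, meets $\partial T$ in one arc, and inside $T$ is the standard band from $C$ to $\partial T$. Here $C$ is the Whitehead curve if $k=0$; the $(k+1)$-st Milnor curve is the standard band sum of one component of the Bing double of the core of $T$ with the $k$-th Milnor curve in a tubular neighborhood of the other component. Opening the clasp of the innermost Whitehead curve makes $C$ trivial in $T$, so an elementary $k$-move is, up to ambient isotopy, a self-crossing change at that clasp. *Fine $k$-quasi-isotopy* is the equivalence relation generated by ambient isotopy and elementary $k$-moves. **Functorial invariance.** A quotient of the (metabelianized) fundamental group assigns to each $m$-component link $L$ a quotient $\pi(L)\to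 Q(L)$ (through $\pi(L)/\pi(L)''$), independently of the base point. It is *functorially invariant* under $k$-quasi-isotopy (respectively, fine $k$-quasi-isotopy) if it is invariant under ambient isotopy and, for each self-crossing change $L_0\leftrightarrow L_1$ allowed in a $k$-quasi-isotopy (respectively, given by the clasp of an elementary $k$-move), with singular link $L_s$, there is an isomorphism $Q(L_0)\cong Q(L_1)$ that commutes with the two homomorphisms $$\pi_1\big(S^3\setminus \text{regular neighborhood of } L_s(mS^1)\big)\to\pi(L_j)\to Q(L_j),\qquad j=0,1 .$$ **Theorem 3.7.** Let $m,k\ge 0$. 1. Any quotient of the metabelianized fundamental group of $m$-component links that is functorially invariant under $k$-quasi-isotopy is functorially invariant under fine $k$-quasi-isotopy. 2. For each $m$-component link $L$, the subgroups $\mu_k$ and $\delta_k$ of $\pi(L)$ have the same image in $\pi(L)/\pi(L)''$. -/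

import Mathlib

noncomputable section

/-! ### Group-theoretic part -/

namespace EngelSub

variable {G : Type*} [Group G]

/-- The conjugate `h ^ g = g⁻¹ h g`. -/
def cnj (h g : G) : G := g⁻¹ * h * g

/-- The commutator `[g, h] = g⁻¹ h⁻¹ g h`. -/
def comm (g h : G) : G := g⁻¹ * h⁻¹ * g * h

/-- The iterated normal closure `⟨a⟩_k^G`: `⟨a⟩_0^G = G`, and `⟨a⟩_{k+1}^G` is the normal closure
of `a` in the subgroup `⟨a⟩_k^G`. -/
def iterClosure (a : G) : ℕ → Subgroup G
  | 0 => ⊤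
  | k + 1 => Subgroup.closure {x | ∃ h ∈ iterClosure a k, x = cnj a h}

/-- `μ_k`, for a set `M` of "meridians": generated by the `[a, a ^ g]`, `a ∈ M`,
`g ∈ ⟨a⟩_k^G`. -/
def mu (M : Set G) (k : ℕ) : Subgroup G :=
  Subgroup.closure {x | ∃ a ∈ M, ∃ g ∈ iterClosure a k, x = comm a (cnj a g)}

/-- The left-normed commutator `[g, a, …, a]` with `n` entries `a`. -/
def engel (g a : G) : ℕ → G
  | 0 => g
  | n + 1 => comm (engel g a n) a

/-- `δ_k`: generated by the `[g, a, …, a]` (`k + 2` entries `a`), `a ∈ M`, `g ∈ G`. -/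
def delta (M : Set G) (k : ℕ) : Subgroup G :=
  Subgroup.closure {x | ∃ a ∈ M, ∃ g : G, x = engel g a (k + 2)}

end EngelSub

namespace PLTop

/-! ### PL topology -/

/-- The PL 3-sphere: the boundary of the cube `[-1,1]⁴` (unit sphere of the sup norm). -/
abbrev S3 : Type := Metric.sphere (0 : Fin 4 → ℝ) 1

/-- The PL circle: the boundary of the square `[-1,1]²`. -/
abbrev S1 : Type := Metric.sphere (0 : Fin 2 → ℝ) 1

/-- A compact polyhedron: a finite union of convex hulls of finite sets. -/
def IsPolyhedron {E : Type*} [AddCommGroup E] [Module ℝ E] (P : Set E) : Prop :=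
  ∃ F : Finset (Finset E), P = ⋃ s ∈ F, convexHull ℝ (s : Set E)

/-- `f` is PL on the compact polyhedron `P`: it is continuous and its graph is a polyhedron. -/
def IsPLOn {E : Type*} [AddCommGroup E] [Module ℝ E] [TopologicalSpace E]
    (f : E → S3) (P : Set E) : Prop :=
  ContinuousOn f P ∧ IsPolyhedron ((fun x => (x, (f x : Fin 4 → ℝ))) '' P)

/-- `f` is PL on `P` and embeds `P`. -/
def IsPLEmbOn {E : Type*} [AddCommGroup E] [Module ℝ E] [TopologicalSpace E]
    (f : E → S3) (P : Set E) : Prop :=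
  IsPLOn f P ∧ Set.InjOn f P

/-- A PL closed curve in `S³`. -/
def IsPLLoop (f : S1 → S3) : Prop :=
  Continuous f ∧
    IsPolyhedron (Set.range fun θ : S1 => ((θ : Fin 2 → ℝ), (f θ : Fin 4 → ℝ)))

/-- `h` is the final homeomorphism of a PL ambient isotopy of `S³`. -/
def IsPLIsotopicToId (h : S3 ≃ₜ S3) : Prop :=
  ∃ H : S3 × unitInterval → S3, Continuous H ∧
    IsPolyhedron (Set.range fun z : S3 × unitInterval =>
      (((z.1 : Fin 4 → ℝ), (z.2 : ℝ)), (H z : Fin 4 → ℝ))) ∧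
    (∀ t, Function.Bijective fun x => H (x, t)) ∧
    (∀ x, H (x, 0) = x) ∧ ∀ x, H (x, 1) = h x

/-- The cube `[-1,1]³`. -/
def cube : Set (Fin 3 → ℝ) := Set.Icc (-1) 1

/-! ### Links, their groups and meridians -/

/-- An `m`-component PL link `mS¹ ↪ S³`. -/
structure PLLink (m : ℕ) where
  toFun : Fin m → S1 → S3
  pl : ∀ c, IsPLLoop (toFun c)
  inj : Function.Injective fun z : Fin m × S1 => toFun z.1 z.2

/-- The image of a map `mS¹ → S³`. -/
def image {m : ℕ} (f : Fin m → S1 → S3) : Set S3 := {x | ∃ c θ, f c θ = x}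

/-- The complement of a link. -/
def PLLink.compl {m : ℕ} (L : PLLink m) : Set S3 := (image L.toFun)ᶜ

/-- The fundamental group `π(L)`, based at `x`. -/
abbrev PLLink.grp {m : ℕ} (L : PLLink m) (x : L.compl) : Type := FundamentalGroup L.compl x

/-- A PL tube around an arc of the link `L`: a PL embedding of the cube that meets `L` exactly
in the image of the third coordinate axis. -/
structure Tube {m : ℕ} (L : PLLink m) where
  e : (Fin 3 → ℝ) → S3
  pl : IsPLEmbOn e cube
  axis : ∀ u ∈ cube, e u ∈ image L.toFun ↔ u 0 = 0 ∧ u 1 = 0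

/-- The cube without the third coordinate axis; its fundamental group is infinite cyclic. -/
def puncturedCube : Set (Fin 3 → ℝ) := {u | u ∈ cube ∧ ¬ (u 0 = 0 ∧ u 1 = 0)}

/-- The embedding of the punctured cube in the link complement given by a tube. -/
def Tube.emb {m : ℕ} {L : PLLink m} (τ : Tube L) : C(puncturedCube, L.compl) where
  toFun u := ⟨τ.e u, fun h => u.2.2 ((τ.axis u u.2.1).1 h)⟩
  continuous_toFun := by
    refine Continuous.subtype_mk ?_ _
    exact (τ.pl.1.1.mono fun u hu => hu.1).domRestrict

/-- The set `M` of all meridians of `L` (of all components, with both orientations): a generator of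
the fundamental group of a punctured tube around an arc of `L`, connected to the base point by an
arbitrary path. -/
def PLLink.meridians {m : ℕ} (L : PLLink m) (x : L.compl) : Set (L.grp x) :=
  {g | ∃ (τ : Tube L) (y : puncturedCube) (γ : Path (τ.emb y) x)
    (u : FundamentalGroup puncturedCube y), (∀ v, v ∈ Subgroup.zpowers u) ∧
      g = FundamentalGroup.fundamentalGroupMulEquivOfPath γ (FundamentalGroup.map τ.emb y u)}

/-! ### Quasi-embeddings and crossing changes -/

/-- A (closed) arc in the circle. -/
def IsArc (J : Set S1) : Prop :=
  ∃ γ : unitInterval → S1, Continuous γ ∧ Function.Injective γ ∧ J = Set.range γ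

/-- `f : mS¹ → S³` is PL, and its only double point is `f i p = f i q`. -/
def HasSingleDoublePoint {m : ℕ} (f : Fin m → S1 → S3) (i : Fin m) (p q : S1) : Prop :=
  (∀ c, IsPLLoop (f c)) ∧ p ≠ q ∧ f i p = f i q ∧
    ∀ c θ c' θ', f c θ = f c' θ' → (c = c' ∧ θ = θ') ∨
      (c = i ∧ c' = i ∧ ((θ = p ∧ θ' = q) ∨ (θ = q ∧ θ' = p)))

/-- `f : mS¹ → S³` is a `k`-quasi-embedding with a single double point. -/
def IsSingularQuasiEmbedding {m : ℕ} (k : ℕ) (f : Fin m → S1 → S3) : Prop :=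
  ∃ (i : Fin m) (p q : S1), HasSingleDoublePoint f i p q ∧
    ∃ (P : ℕ → Set S3) (J : ℕ → Set S1), P 0 = {f i p} ∧
      (∀ j < k, IsPolyhedron (Subtype.val '' P (j + 1)) ∧
        (∀ c, c ≠ i → ∀ θ, f c θ ∉ P (j + 1)) ∧
        IsArc (J j) ∧ (j + 1 < k → J j ⊆ J (j + 1)) ∧
        f i ⁻¹' P j ⊆ J j ∧
        ∃ h : P j ∪ f i '' J j ⊆ P (j + 1), (ContinuousMap.inclusion h).Nullhomotopic)

/-- A self-crossing change `pos ↔ neg` of the component `i`, through the singular link `sing`.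
In the ball `e(cube)` the three maps are two strands parametrized by the subarcs `a`, `b` of the
circle: `b` runs along the second coordinate axis, and `a` runs above, through, respectively below
it along the first axis. Outside the ball the three maps coincide. -/
structure CrossingChange (m : ℕ) where
  pos : PLLink m
  neg : PLLink m
  sing : Fin m → S1 → S3
  sing_pl : ∀ c, IsPLLoop (sing c)
  i : Fin m
  e : (Fin 3 → ℝ) → S3
  e_pl : IsPLEmbOn e cube
  a : Set.Icc (-1 : ℝ) 1 → S1
  b : Set.Icc (-1 : ℝ) 1 → S1
  a_cont : Continuous a
  b_cont : Continuous b
  sing_a : ∀ t, sing i (a t) = e ![t, 0, 0]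
  pos_a : ∀ t, pos.toFun i (a t) = e ![t, 0, (1 - |(t : ℝ)|) / 2]
  neg_a : ∀ t, neg.toFun i (a t) = e ![t, 0, -((1 - |(t : ℝ)|) / 2)]
  sing_b : ∀ t, sing i (b t) = e ![0, t, 0]
  pos_b : ∀ t, pos.toFun i (b t) = e ![0, t, 0]
  neg_b : ∀ t, neg.toFun i (b t) = e ![0, t, 0]
  outside : ∀ c θ, ¬ (c = i ∧ θ ∈ Set.range a ∪ Set.range b) →
    sing c θ ∉ e '' cube ∧ pos.toFun c θ = sing c θ ∧ neg.toFun c θ = sing c θ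

namespace CrossingChange

variable {m : ℕ} (X : CrossingChange m)

/-- The exterior of the singular link: the complement of the union of its image with the ball
`e(cube)` around the double point. It is homotopy equivalent to the exterior of a regular
neighborhood of the image of `sing` that contains both `pos` and `neg`. -/
def ext : Set S3 := (image X.sing ∪ X.e '' cube)ᶜ

theorem strand_mem_cube {s t r : ℝ} (hs : |s| ≤ 1) (ht : |t| ≤ 1) (hr : |r| ≤ 1) :
    ![s, t, r] ∈ cube := by
  rw [abs_le] at hs ht hr
  constructor <;> intro j <;> fin_cases j <;> simp <;> linarith

theorem ext_sub_pos : X.ext ⊆ X.pos.compl := by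
  rintro x hx ⟨c, θ, rfl⟩
  by_cases h : c = X.i ∧ θ ∈ Set.range X.a ∪ Set.range X.b
  · obtain ⟨rfl, ⟨t, rfl⟩ | ⟨t, rfl⟩⟩ := h
    · have ht : |(t : ℝ)| ≤ 1 := abs_le.2 t.2
      have h0 := abs_nonneg (t : ℝ)
      refine hx (Or.inr ⟨_, ?_, (X.pos_a t).symm⟩)
      exact strand_mem_cube ht (by simp) (abs_le.2 ⟨by linarith, by linarith⟩)
    · exact hx (Or.inr ⟨_, strand_mem_cube (by simp) (abs_le.2 t.2) (by simp),
        (X.pos_b t).symm⟩)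
  · exact hx (Or.inl ⟨c, θ, (X.outside c θ h).2.1.symm⟩)

theorem ext_sub_neg : X.ext ⊆ X.neg.compl := by
  rintro x hx ⟨c, θ, rfl⟩
  by_cases h : c = X.i ∧ θ ∈ Set.range X.a ∪ Set.range X.b
  · obtain ⟨rfl, ⟨t, rfl⟩ | ⟨t, rfl⟩⟩ := h
    · have ht : |(t : ℝ)| ≤ 1 := abs_le.2 t.2
      have h0 := abs_nonneg (t : ℝ)
      refine hx (Or.inr ⟨_, ?_, (X.neg_a t).symm⟩)
      exact strand_mem_cube ht (by simp) (abs_le.2 ⟨by linarith, by linarith⟩)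
    · exact hx (Or.inr ⟨_, strand_mem_cube (by simp) (abs_le.2 t.2) (by simp),
        (X.neg_b t).symm⟩)
  · exact hx (Or.inl ⟨c, θ, (X.outside c θ h).2.2.symm⟩)

/-- The crossing change is allowed in a `k`-quasi-isotopy. -/
def IsAllowed (k : ℕ) : Prop := IsSingularQuasiEmbedding k X.sing

end CrossingChange

/-! ### Milnor curves and elementary moves -/

/-- The standard solid torus in `ℝ³`: a square annulus times an interval. -/
def solidTorus : Set (Fin 3 → ℝ) :=
  {v | |v 0| ≤ 3 ∧ |v 1| ≤ 3 ∧ |v 2| ≤ 1 ∧ (1 ≤ |v 0| ∨ 1 ≤ |v 1|)}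

/-- The polygonal path with the given vertices; the `n`-th edge is traversed for
`n ≤ t ≤ n + 1`. -/
def polyPath : List (Fin 3 → ℝ) → ℝ → Fin 3 → ℝ
  | [], _ => 0
  | [v], _ => v
  | v :: w :: l, t => if t ≤ 1 then AffineMap.lineMap v w t else polyPath (w :: l) (t - 1)

/-- The affine embedding of the standard solid torus in itself onto a neighborhood of one of the two
components of the Bing double of its core. -/
def bing (v : Fin 3 → ℝ) : Fin 3 → ℝ := ![2 + v 2 / 6, v 0 / 6, v 1 / 6]

/-- The first end on the boundary of the solid torus of the half-band. -/
def bandA : Fin 3 → ℝ := ![-3, 0, 1 / 2]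

/-- The second end on the boundary of the solid torus of the half-band. -/
def bandB : Fin 3 → ℝ := ![-3, 0, -1 / 2]

/-- The vertices of the singular `k`-th Milnor curve in the standard solid torus, opened along the
edge from the last vertex `(-2, -1/2, 0)` to the first vertex `(-2, 1/2, 0)`.
For `k = 0` this is the Whitehead curve with its clasp at the moment of the crossing change, at the
point `(9/4, 1/4, 0)`. The `(k+1)`-st curve is the band sum of the second component of the
Bing double of the core with the image of the `k`-th curve under `bing`. Moving the edge of
the innermost curve that runs along the first axis up, respectively down, off the
double point gives the Milnor curve, respectively an unknot in a ball in the solid torus. -/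
def milnorChain : ℕ → List (Fin 3 → ℝ)
  | 0 => [![-2, 1/2, 0], ![-2, 2, 0], ![9/4, 2, 0], ![9/4, 0, 0], ![9/4, -1/4, 1/4],
      ![5/4, -1/4, 1/4], ![5/4, 0, 0], ![5/4, 5/4, 0], ![-5/4, 5/4, 0], ![-5/4, -5/4, 0],
      ![7/4, -5/4, 0], ![7/4, 1/4, 0], ![11/4, 1/4, 0], ![11/4, -2, 0], ![-2, -2, 0],
      ![-2, -1/2, 0]]
  | k + 1 => [![-2, 1/2, 0], ![-2, 2, 0], ![5/2, 2, 0], ![5/2, 1/12, 0], ![3/2, 1/12, 0],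
      ![3/2, 3/2, 0], ![-3/2, 3/2, 0], ![-3/2, -3/2, 0], ![3/2, -3/2, 0], ![3/2, -1/12, 0],
      ![5/2, -1/12, 0], ![5/2, -2, 0], ![25/12, -2, 0]] ++
      (bandA :: (milnorChain k ++ [bandB])).map bing ++
      [![23/12, -2, 0], ![-2, -2, 0], ![-2, -1/2, 0]]

/-- The vertices of the proper polygonal arc in the solid torus that is formed by the opened singular
`k`-th Milnor curve together with the two long edges of the standard half-band,
which has the corners `(-2, 1/2, 0)`, `(-2, -1/2, 0)`, `bandB`, `bandA`. -/
def milnorArc (k : ℕ) : List (Fin 3 → ℝ) := bandA :: (milnorChain k ++ [bandB])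

/-- The number of edges of `milnorArc k`. -/
def milnorEdges (k : ℕ) : ℝ := ((milnorArc k).length : ℝ) - 1

/-- A cube around the double point of the singular Whitehead curve; its first two axes run along the two
strands of the curve. -/
def claspChart (u : Fin 3 → ℝ) : Fin 3 → ℝ := ![9/4 + u 0 / 8, 1/4 + u 1 / 8, u 2 / 8]

/-- `X` is the crossing change of an elementary `k`-move on `L`. There is a PL solid torus
`T = τ(solidTorus)` in the complement of `L`, and a band `β([0,1]²)` outside `T` that joins the
end `τ([bandA, bandB])` of the standard half-band in `T` to an arc of `L`. The singular link `X.sing`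
is the interior connected sum, along the union of the two bands, of `L` and the singular
`k`-th Milnor curve in `T`; the crossing change is that of the clasp of the Milnor curve. So `X.pos`
is the result of the elementary `k`-move on `L`, and `X.neg` is ambient isotopic to `L`. -/
def IsElementaryMove {m : ℕ} (k : ℕ) (L : PLLink m) (X : CrossingChange m) : Prop :=
  ∃ (τ : (Fin 3 → ℝ) → S3) (β : ℝ × ℝ → S3) (κ : ℝ → S1),
    IsPLEmbOn τ solidTorus ∧ Disjoint (τ '' solidTorus) (image L.toFun) ∧
    IsPLEmbOn β (Set.Icc 0 1 ×ˢ Set.Icc 0 1) ∧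
    (∀ s ∈ Set.Icc (0 : ℝ) 1, β (s, 0) = τ (AffineMap.lineMap bandA bandB s)) ∧
    (∀ s ∈ Set.Icc (0 : ℝ) 1, ∀ t ∈ Set.Icc (0 : ℝ) 1,
      (β (s, t) ∈ τ '' solidTorus ↔ t = 0) ∧ (β (s, t) ∈ image L.toFun ↔ t = 1)) ∧
    -- `κ` parametrizes the arc of the circle that is mapped by `L` onto the end of the band
    ContinuousOn κ (Set.Icc (-1) (milnorEdges k + 1)) ∧
    Set.InjOn κ (Set.Icc (-1) (milnorEdges k + 1)) ∧
    L.toFun X.i '' (κ '' Set.Icc (-1) (milnorEdges k + 1)) =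
      (fun s => β (s, 1)) '' Set.Icc (0 : ℝ) 1 ∧
    (∀ c θ, ¬ (c = X.i ∧ θ ∈ κ '' Set.Icc (-1) (milnorEdges k + 1)) →
      X.sing c θ = L.toFun c θ) ∧
    (∀ t ∈ Set.Icc (0 : ℝ) 1, X.sing X.i (κ (-t)) = β (0, t)) ∧
    (∀ t ∈ Set.Icc 0 (milnorEdges k), X.sing X.i (κ t) = τ (polyPath (milnorArc k) t)) ∧
    (∀ t ∈ Set.Icc (0 : ℝ) 1, X.sing X.i (κ (milnorEdges k + t)) = β (1, t)) ∧
    ∀ u ∈ cube, X.e u = τ (bing^[k] (claspChart u))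

/-! ### Quotients of link groups and functorial invariance -/

/-- A quotient of the fundamental groups of `m`-component links: a normal subgroup `ker L x` of
`π₁(S³ ∖ L, x)` for each link `L` and base point `x`, compatible with changes of base point. -/
structure GroupQuotient (m : ℕ) where
  ker : ∀ (L : PLLink m) (x : L.compl), Subgroup (L.grp x)
  normal : ∀ L x, (ker L x).Normal
  basepoint : ∀ (L : PLLink m) (x y : L.compl) (γ : Path x y),
    (ker L x).map (FundamentalGroup.fundamentalGroupMulEquivOfPath γ).toMonoidHom = ker L y

attribute [instance] GroupQuotient.normal

/-- The homeomorphism of complements induced by a homeomorphism of `S³` that takes `L` to `L'`. -/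
def complMap {m : ℕ} {L L' : PLLink m} (h : S3 ≃ₜ S3)
    (hL : ∀ c θ, L'.toFun c θ = h (L.toFun c θ)) : C(L.compl, L'.compl) where
  toFun x := ⟨h x, by
    rintro ⟨c, θ, hx⟩
    rw [hL] at hx
    exact x.2 ⟨c, θ, h.injective hx⟩⟩
  continuous_toFun := (h.continuous.comp continuous_subtype_val).subtype_mk _

namespace GroupQuotient

variable {m : ℕ} (Q : GroupQuotient m)

/-- `Q` is a quotient of the metabelianized fundamental group `π/π''`. -/
def IsMetabelian : Prop := ∀ (L : PLLink m) (x : L.compl), derivedSeries (L.grp x) 2 ≤ Q.ker L x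

/-- `Q` is an invariant of ambient isotopy. -/
def IsotopyInvariant : Prop :=
  ∀ (L L' : PLLink m) (h : S3 ≃ₜ S3) (_ : IsPLIsotopicToId h)
    (hL : ∀ c θ, L'.toFun c θ = h (L.toFun c θ)) (x : L.compl),
    (Q.ker L x).map (FundamentalGroup.map (complMap h hL) x) = Q.ker L' (complMap h hL x)

/-- There is an isomorphism `Q(pos) ≅ Q(neg)` that makes the diagram with the
homomorphisms from the fundamental group of the exterior of the singular link commute. -/
def Respects (X : CrossingChange m) : Prop :=
  ∀ x : X.ext, ∃ φ :
    (X.pos.grp ⟨x, X.ext_sub_pos x.2⟩ ⧸ Q.ker X.pos ⟨x, X.ext_sub_pos x.2⟩) ≃*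
      (X.neg.grp ⟨x, X.ext_sub_neg x.2⟩ ⧸ Q.ker X.neg ⟨x, X.ext_sub_neg x.2⟩),
    ∀ g : FundamentalGroup X.ext x,
      φ (QuotientGroup.mk (FundamentalGroup.map (ContinuousMap.inclusion X.ext_sub_pos) x g)) =
        QuotientGroup.mk (FundamentalGroup.map (ContinuousMap.inclusion X.ext_sub_neg) x g)

/-- Functorial invariance under `k`-quasi-isotopy. -/
def FunctoriallyInvariant (k : ℕ) : Prop :=
  Q.IsotopyInvariant ∧ ∀ X : CrossingChange m, X.IsAllowed k → Q.Respects X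

/-- Functorial invariance under fine `k`-quasi-isotopy, the relation that is generated by ambient
isotopy and elementary `k`-moves. -/
def FinelyFunctoriallyInvariant (k : ℕ) : Prop :=
  Q.IsotopyInvariant ∧
    ∀ (L : PLLink m) (X : CrossingChange m), IsElementaryMove k L X → Q.Respects X

end GroupQuotient

end PLTop

end

/-!
Commutators of a metabelian group act trivially, by conjugation, on its derived subgroup. Hence
`[a, a^g] = [a, [a, g]] = [g, a, a]`, and for a fixed `a` the commutators `[g, a, …, a]` of given
length at least two generate a normal subgroup. Modulo this subgroup the elements commuting with `a`
form a subgroup, so by induction on `k` the commutators `[g, a]` with `g ∈ ⟨a⟩_k` lie in the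
subgroup generated by the `[h, a, …, a]` with `k + 1` entries `a`. Conversely, such a commutator
with `k` entries lies in `⟨a⟩_k`.

The solid torus `T` of an elementary `k`-move contains a decreasing sequence of solid tori
`T = T_0 ⊃ ⋯ ⊃ T_k`, each a neighborhood of a component of the Bing double of the core of the
preceding one. The clasp lies in `T_k`, the singular Milnor curve meets each `T_n` in a single arc,
and between `T_{n + 1}` and `T_n` there is a ball. So the polyhedra `P_j = T_{k - j}`, for `j > 0`,
together with these arcs show that the crossing change at the clasp passes through a
`k`-quasi-embedding.
-/

/-! ### Commutators in metabelian groups -/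

namespace EngelSub

section Map

variable {G H : Type*} [Group G] [Group H] (f : G →* H)

theorem map_comm (g h : G) : f (comm g h) = comm (f g) (f h) := by simp [comm]

theorem map_cnj (h g : G) : f (cnj h g) = cnj (f h) (f g) := by simp [cnj]

theorem map_engel (g a : G) (n : ℕ) : f (engel g a n) = engel (f g) (f a) n := by
  induction n with
  | zero => rfl
  | succ n ih => simp only [engel, map_comm, ih]

variable {f}

theorem map_iterClosure (hf : Function.Surjective f) (a : G) (k : ℕ) :
    (iterClosure a k).map f = iterClosure (f a) k := by
  induction k with
  | zero => exact Subgroup.map_top_of_surjective f hf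
  | succ k ih =>
    rw [iterClosure, iterClosure, MonoidHom.map_closure, ← ih]
    congr 1
    ext x
    constructor
    · rintro ⟨_, ⟨h, hh, rfl⟩, rfl⟩
      exact ⟨f h, ⟨h, hh, rfl⟩, map_cnj f a h⟩
    · rintro ⟨_, ⟨h, hh, rfl⟩, rfl⟩
      exact ⟨_, ⟨h, hh, rfl⟩, map_cnj f a h⟩

theorem map_mu (hf : Function.Surjective f) (M : Set G) (k : ℕ) :
    (mu M k).map f = mu (f '' M) k := by
  rw [mu, mu, MonoidHom.map_closure]
  congr 1
  ext x
  constructor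
  · rintro ⟨_, ⟨a, ha, g, hg, rfl⟩, rfl⟩
    refine ⟨f a, ⟨a, ha, rfl⟩, f g, ?_, by rw [map_comm, map_cnj]⟩
    exact map_iterClosure hf a k ▸ Subgroup.mem_map_of_mem f hg
  · rintro ⟨_, ⟨a, ha, rfl⟩, g, hg, rfl⟩
    rw [← map_iterClosure hf] at hg
    obtain ⟨g, hg, rfl⟩ := hg
    exact ⟨_, ⟨a, ha, g, hg, rfl⟩, by rw [map_comm, map_cnj]⟩

theorem map_delta (hf : Function.Surjective f) (M : Set G) (k : ℕ) :
    (delta M k).map f = delta (f '' M) k := by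
  rw [delta, delta, MonoidHom.map_closure]
  congr 1
  ext x
  constructor
  · rintro ⟨_, ⟨a, ha, g, rfl⟩, rfl⟩
    exact ⟨f a, ⟨a, ha, rfl⟩, f g, map_engel f g a _⟩
  · rintro ⟨_, ⟨a, ha, rfl⟩, g, rfl⟩
    obtain ⟨g, rfl⟩ := hf g
    exact ⟨_, ⟨a, ha, g, rfl⟩, map_engel f g a _⟩

end Map

variable {G : Type*} [Group G]

theorem comm_inv (g h : G) : (comm g h)⁻¹ = comm h g := by simp [comm, mul_assoc]

theorem comm_mul_left (g h a : G) : comm (g * h) a = cnj (comm g a) h * comm h a := by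
  simp only [comm, cnj]; group

theorem comm_mul_right (g a b : G) : comm g (a * b) = comm g b * cnj (comm g a) b := by
  simp only [comm, cnj]; group

theorem comm_inv_left (g a : G) : comm g⁻¹ a = cnj (comm g a)⁻¹ g⁻¹ := by
  simp only [comm, cnj]; group

theorem comm_cnj_self (a g : G) : comm a (cnj a g) = comm a (comm a g) := by
  simp only [comm, cnj]; group

theorem comm_cnj_left (a h : G) : comm (cnj a h) a = comm (comm a h) a := by
  simp only [comm, cnj]; group

theorem cnj_comm (g a h : G) : cnj (comm g a) h = comm (cnj g h) (a * comm a h) := by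
  simp only [comm, cnj]; group

theorem comm_mem_commutator (g h : G) : comm g h ∈ commutator G := by
  simpa [commutator_def, commutatorElement_def, comm] using
    Subgroup.commutator_mem_commutator (Subgroup.mem_top g⁻¹) (Subgroup.mem_top h⁻¹)

theorem engel_succ_mem_commutator (g a : G) (n : ℕ) : engel g a (n + 1) ∈ commutator G :=
  comm_mem_commutator _ _

theorem cnj_mem {N : Subgroup G} [N.Normal] {x : G} (hx : x ∈ N) (g : G) : cnj x g ∈ N := by
  simpa [cnj] using ‹N.Normal›.conj_mem x hx g⁻¹

theorem engel_mem_iterClosure (g a : G) (k : ℕ) : engel g a k ∈ iterClosure a k := by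
  induction k with
  | zero => trivial
  | succ k ih =>
    have h₁ : cnj a (engel g a k) ∈ iterClosure a (k + 1) :=
      Subgroup.subset_closure ⟨_, ih, rfl⟩
    have h₂ : cnj a 1 ∈ iterClosure a (k + 1) := Subgroup.subset_closure ⟨1, one_mem _, rfl⟩
    have h : engel g a (k + 1) = (cnj a (engel g a k))⁻¹ * cnj a 1 := by
      simp only [engel, comm, cnj]; group
    exact h ▸ mul_mem (inv_mem h₁) h₂

/-- Modulo a normal subgroup, the elements commuting with `a` form a subgroup. -/
theorem comm_mem_of_mem_closure {N : Subgroup G} [N.Normal] {S : Set G} {a x : G}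
    (hS : ∀ g ∈ S, comm g a ∈ N) (hx : x ∈ Subgroup.closure S) : comm x a ∈ N := by
  induction hx using Subgroup.closure_induction with
  | mem g hg => exact hS g hg
  | one => simp [comm]
  | mul g h _ _ ihg ihh => exact comm_mul_left g h a ▸ mul_mem (cnj_mem ihg h) ihh
  | inv g _ ih => exact comm_inv_left g a ▸ cnj_mem (inv_mem ih) _

/-- The subgroup generated by the Engel commutators `[g, a, …, a]` with `n` entries `a`, for fixed
`a` and all `g`: the contribution of a single meridian to `delta`. -/
def engelClosure (a : G) (n : ℕ) : Subgroup G :=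
  Subgroup.closure (Set.range fun g => engel g a n)

theorem engel_mem_engelClosure (g a : G) (n : ℕ) : engel g a n ∈ engelClosure a n :=
  Subgroup.subset_closure ⟨g, rfl⟩

theorem engelClosure_le_delta {M : Set G} {a : G} (ha : a ∈ M) (k : ℕ) :
    engelClosure a (k + 2) ≤ delta M k :=
  Subgroup.closure_mono fun _ ⟨g, hg⟩ => ⟨a, ha, g, hg.symm⟩

section Metabelian

variable [IsMulCommutative (commutator G)] {x y : G}

theorem cnj_eq_self (hx : x ∈ commutator G) (hy : y ∈ commutator G) : cnj x y = x := by
  rw [cnj, mul_assoc, setLike_mul_comm hx hy, inv_mul_cancel_left]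

theorem comm_eq_one (hx : x ∈ commutator G) (hy : y ∈ commutator G) : comm x y = 1 := by
  rw [comm, mul_assoc, setLike_mul_comm hx hy]
  group

theorem comm_mul_of_mem_commutator (hy : y ∈ commutator G) (a : G) :
    comm (x * y) a = comm x a * comm y a := by
  rw [comm_mul_left, cnj_eq_self (comm_mem_commutator _ _) hy]

theorem comm_comm_eq (a g : G) : comm a (comm a g) = comm (comm g a) a := by
  have hga := comm_mem_commutator g a
  rw [← comm_inv, ← comm_inv g a, comm_inv_left,
    cnj_eq_self (inv_mem (comm_mem_commutator _ _)) (inv_mem hga), inv_inv]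

theorem cnj_comm_of_mem_commutator (hx : x ∈ commutator G) (a h : G) :
    cnj (comm x a) h = comm (cnj x h) a := by
  rw [cnj_comm, comm_mul_right, comm_eq_one (cnj_mem hx h) (comm_mem_commutator a h), one_mul,
    cnj_eq_self (comm_mem_commutator _ _) (comm_mem_commutator a h)]

theorem engel_mul (g h a : G) (n : ℕ) :
    engel (g * h) a (n + 1) = cnj (engel g a (n + 1)) h * engel h a (n + 1) := by
  induction n with
  | zero => exact comm_mul_left g h a
  | succ n ih =>
    rw [engel, ih, comm_mul_of_mem_commutator (engel_succ_mem_commutator h a n),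
      ← cnj_comm_of_mem_commutator (engel_succ_mem_commutator g a n), ← engel, ← engel]

instance engelClosure_normal (a : G) (n : ℕ) : (engelClosure a (n + 1)).Normal where
  conj_mem x hx g := by
    suffices engelClosure a (n + 1) ≤
        (engelClosure a (n + 1)).comap (MulAut.conj g).toMonoidHom from this hx
    refine (Subgroup.closure_le _).2 ?_
    rintro _ ⟨h, rfl⟩
    have hcnj : cnj (engel h a (n + 1)) g⁻¹ =
        engel (h * g⁻¹) a (n + 1) * (engel g⁻¹ a (n + 1))⁻¹ :=
      eq_mul_inv_of_mul_eq (engel_mul h g⁻¹ a n).symm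
    have hmem : cnj (engel h a (n + 1)) g⁻¹ ∈ engelClosure a (n + 1) :=
      hcnj ▸ mul_mem (engel_mem_engelClosure _ a _) (inv_mem (engel_mem_engelClosure _ a _))
    simpa [cnj] using hmem

theorem comm_mem_engelClosure {a : G} {n : ℕ} (hx : x ∈ engelClosure a (n + 1)) :
    comm x a ∈ engelClosure a (n + 2) :=
  comm_mem_of_mem_closure (Set.forall_mem_range.2 fun g => engel_mem_engelClosure g a (n + 2)) hx

theorem comm_mem_engelClosure_of_mem_iterClosure {a g : G} {k : ℕ} (hg : g ∈ iterClosure a k) :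
    comm g a ∈ engelClosure a (k + 1) := by
  induction k generalizing g with
  | zero => exact engel_mem_engelClosure g a 1
  | succ k ih =>
    refine comm_mem_of_mem_closure ?_ hg
    rintro _ ⟨h, hh, rfl⟩
    rw [comm_cnj_left, ← comm_inv h a]
    exact comm_mem_engelClosure (inv_mem (ih hh))

theorem mu_eq_delta (M : Set G) (k : ℕ) : mu M k = delta M k := by
  apply le_antisymm
  · refine (Subgroup.closure_le _).2 ?_
    rintro _ ⟨a, ha, g, hg, rfl⟩
    rw [comm_cnj_self, comm_comm_eq]
    exact engelClosure_le_delta ha k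
      (comm_mem_engelClosure (comm_mem_engelClosure_of_mem_iterClosure hg))
  · refine (Subgroup.closure_le _).2 ?_
    rintro _ ⟨a, ha, g, rfl⟩
    refine Subgroup.subset_closure ⟨a, ha, engel g a k, engel_mem_iterClosure g a k, ?_⟩
    rw [comm_cnj_self, comm_comm_eq, engel, engel]

end Metabelian

theorem isMulCommutative_commutator_of_derivedSeries_eq_bot (h : derivedSeries G 2 = ⊥) :
    IsMulCommutative (commutator G) := by
  rw [derivedSeries_succ, derivedSeries_one, Subgroup.commutator_eq_bot_iff_le_centralizer] at h
  exact .of_setLike_mul_comm fun x hx y hy => Subgroup.mem_centralizer_iff.1 (h hy) x hx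

instance isMulCommutative_commutator_metabelianization :
    IsMulCommutative (commutator (G ⧸ derivedSeries G 2)) :=
  isMulCommutative_commutator_of_derivedSeries_eq_bot <| by
    rw [← map_derivedSeries_eq (QuotientGroup.mk'_surjective (derivedSeries G 2)),
      QuotientGroup.map_mk'_self]

theorem map_mu_eq_map_delta (M : Set G) (k : ℕ) :
    (mu M k).map (QuotientGroup.mk' (derivedSeries G 2)) =
      (delta M k).map (QuotientGroup.mk' (derivedSeries G 2)) := by
  have hs := QuotientGroup.mk'_surjective (derivedSeries G 2)
  rw [map_mu hs, map_delta hs, mu_eq_delta]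

end EngelSub

namespace PLTop

/-! ### Polyhedra -/

section Crossing

variable {𝕜 E : Type*} [Field 𝕜] [AddCommGroup E] [Module 𝕜 E] {l : E →ᵃ[𝕜] 𝕜} {u v x : E}

/-- The point where the line through `u` and `v` crosses the hyperplane `l = 0`; a junk value if
`l u = l v`. -/
def crossing (l : E →ᵃ[𝕜] 𝕜) (u v : E) : E := (l v - l u)⁻¹ • (l v • u - l u • v)

theorem sub_smul_crossing (h : l u ≠ l v) :
    (l v - l u) • crossing l u v = l v • u - l u • v :=
  smul_inv_smul₀ (sub_ne_zero.2 h.symm) _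

theorem crossing_eq_combo : crossing l u v =
    (l v / (l v - l u)) • u + (-l u / (l v - l u)) • v := by
  rw [crossing, smul_sub, smul_smul, smul_smul, inv_mul_eq_div, inv_mul_eq_div, neg_div, neg_smul,
    sub_eq_add_neg]

theorem crossing_swap (l : E →ᵃ[𝕜] 𝕜) (u v : E) : crossing l v u = crossing (-l) u v := by
  simp only [crossing, AffineMap.coe_neg, Pi.neg_apply, neg_smul, sub_neg_eq_add,
    neg_add_eq_sub]

theorem apply_crossing (h : l u ≠ l v) : l (crossing l u v) = 0 := by
  have hD : l v - l u ≠ 0 := sub_ne_zero.2 h.symm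
  rw [crossing_eq_combo, Convex.combo_affine_apply]
  · simp only [smul_eq_mul]
    ring
  · rw [← add_div, ← sub_eq_add_neg, div_self hD]

variable [LinearOrder 𝕜] [IsStrictOrderedRing 𝕜]

theorem crossing_mem_segment (hu : l u ≤ 0) (hv : 0 < l v) : crossing l u v ∈ segment 𝕜 u v := by
  have hD : 0 < l v - l u := by linarith
  refine ⟨_, _, div_nonneg hv.le hD.le, div_nonneg (neg_nonneg.2 hu) hD.le, ?_,
    crossing_eq_combo.symm⟩
  rw [← add_div, ← sub_eq_add_neg, div_self hD.ne']

theorem mem_segment_crossing (hu : l u ≤ 0) (hv : 0 < l v) (hx : x ∈ segment 𝕜 u v)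
    (hlx : l x ≤ 0) : x ∈ segment 𝕜 u (crossing l u v) := by
  obtain ⟨a, b, ha, hb, hab, rfl⟩ := hx
  rw [Convex.combo_affine_apply hab, smul_eq_mul, smul_eq_mul] at hlx
  rcases hu.eq_or_lt with hu | hu
  · have hb0 : b = 0 := by
      rw [hu, mul_zero, zero_add] at hlx
      exact le_antisymm (nonpos_of_mul_nonpos_left hlx hv) hb
    obtain rfl : a = 1 := by rw [← hab, hb0, add_zero]
    simpa [hb0] using left_mem_segment 𝕜 u _
  · have hu' : l u ≠ 0 := hu.ne
    have hD : l v - l u ≠ 0 := by linarith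
    refine ⟨1 - b * (l v - l u) / -l u, b * (l v - l u) / -l u, ?_,
      div_nonneg (mul_nonneg hb (by linarith)) (by linarith), sub_add_cancel _ _, ?_⟩
    · rw [sub_nonneg, div_le_one (by linarith)]
      linear_combination hlx - l u * hab
    · obtain rfl : a = 1 - b := eq_sub_of_add_eq hab
      rw [crossing_eq_combo]
      match_scalars <;> field_simp; ring

/-- Projection from `v` to the hyperplane `l = 0` is a perspectivity, so it respects convexity. -/
theorem convex_setOf_crossing_mem (l : E →ᵃ[𝕜] 𝕜) (v : E) {C : Set E} (hC : Convex 𝕜 C) :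
    Convex 𝕜 {u | l u < l v ∧ crossing l u v ∈ C} := by
  rintro u ⟨hu, hu'⟩ w ⟨hw, hw'⟩ a b ha hb hab
  have hl := Convex.combo_affine_apply (f := l) (x := u) (y := w) hab
  simp only [smul_eq_mul] at hl
  have hD : l v - l (a • u + b • w) = a * (l v - l u) + b * (l v - l w) := by
    rw [hl]
    linear_combination -l v * hab
  have hpos : 0 < a * (l v - l u) + b * (l v - l w) := by
    rcases ha.eq_or_lt with rfl | ha
    · obtain rfl : b = 1 := by simpa using hab
      linarith
    · exact add_pos_of_pos_of_nonneg (mul_pos ha (sub_pos.2 hu)) (mul_nonneg hb (sub_pos.2 hw).le)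
  refine ⟨sub_pos.1 (hD ▸ hpos), ?_⟩
  have hcombo : crossing l (a • u + b • w) v =
      (a * (l v - l u) / (a * (l v - l u) + b * (l v - l w))) • crossing l u v +
        (b * (l v - l w) / (a * (l v - l u) + b * (l v - l w))) • crossing l w v := by
    rw [div_eq_inv_mul, div_eq_inv_mul, mul_smul _ (a * _), mul_smul _ (b * _), ← smul_add,
      mul_smul, mul_smul, sub_smul_crossing hu.ne, sub_smul_crossing hw.ne, crossing, hD, hl]
    module
  rw [hcombo]
  exact convex_iff_div.1 hC hu' hw' (mul_nonneg ha (sub_pos.2 hu).le)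
    (mul_nonneg hb (sub_pos.2 hw).le) hpos

theorem convex_setOf_crossing_mem' (l : E →ᵃ[𝕜] 𝕜) (u : E) {C : Set E} (hC : Convex 𝕜 C) :
    Convex 𝕜 {v | l u < l v ∧ crossing l u v ∈ C} := by
  simpa [crossing_swap l] using convex_setOf_crossing_mem (-l) u hC

theorem crossing_mem_of_mem_convexHull {s t C : Set E} (hC : Convex 𝕜 C)
    (hst : ∀ u ∈ s, ∀ v ∈ t, l u < l v ∧ crossing l u v ∈ C)
    (hu : u ∈ convexHull 𝕜 s) (hv : v ∈ convexHull 𝕜 t) : crossing l u v ∈ C := by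
  have h (w : E) (hw : w ∈ t) : l u < l w ∧ crossing l u w ∈ C :=
    convexHull_min (fun z hz => hst z hz w hw) (convex_setOf_crossing_mem l w hC) hu
  exact (convexHull_min h (convex_setOf_crossing_mem' l u hC) hv).2

theorem convexHull_inter_halfspace (s : Set E) (l : E →ᵃ[𝕜] 𝕜) :
    convexHull 𝕜 s ∩ {x | l x ≤ 0} = convexHull 𝕜
      ({v ∈ s | l v ≤ 0} ∪ Set.image2 (crossing l) {v ∈ s | l v ≤ 0} {v ∈ s | 0 < l v}) := by
  set s₀ := {v ∈ s | l v ≤ 0}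
  set s₁ := {v ∈ s | 0 < l v}
  set K := convexHull 𝕜 (s₀ ∪ Set.image2 (crossing l) s₀ s₁)
  have hs : s = s₀ ∪ s₁ := by
    ext v
    simp [s₀, s₁, ← and_or_left, le_or_gt]
  have hl₀ : convexHull 𝕜 s₀ ⊆ {x | l x ≤ 0} :=
    convexHull_min (fun v hv => hv.2) ((convex_Iic (0 : 𝕜)).affine_preimage l)
  have hl₁ : convexHull 𝕜 s₁ ⊆ {x | 0 < l x} :=
    convexHull_min (fun v hv => hv.2) ((convex_Ioi (0 : 𝕜)).affine_preimage l)
  have hs₀K : convexHull 𝕜 s₀ ⊆ K := convexHull_mono Set.subset_union_left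
  apply Set.Subset.antisymm
  · rintro x ⟨hx, hlx⟩
    rcases s₀.eq_empty_or_nonempty with h₀ | h₀
    · rw [hs, h₀, Set.empty_union] at hx
      exact absurd (hl₁ hx) (not_lt.2 hlx)
    rcases s₁.eq_empty_or_nonempty with h₁ | h₁
    · rw [hs, h₁, Set.union_empty] at hx
      exact hs₀K hx
    rw [hs, convexHull_union h₀ h₁] at hx
    obtain ⟨u, hu, v, hv, hx⟩ := mem_convexJoin.1 hx
    refine (convex_convexHull 𝕜 _).segment_subset (hs₀K hu) ?_
      (mem_segment_crossing (hl₀ hu) (hl₁ hv) hx hlx)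
    exact crossing_mem_of_mem_convexHull (convex_convexHull 𝕜 _) (fun u hu v hv =>
      ⟨hu.2.trans_lt hv.2, subset_convexHull 𝕜 _ (.inr ⟨u, hu, v, hv, rfl⟩)⟩) hu hv
  · refine convexHull_min ?_ ((convex_convexHull 𝕜 s).inter
      ((convex_Iic (0 : 𝕜)).affine_preimage l))
    rintro x (⟨hx, hlx⟩ | ⟨u, ⟨hu, hlu⟩, v, ⟨hv, hlv⟩, rfl⟩)
    · exact ⟨subset_convexHull 𝕜 s hx, hlx⟩
    · exact ⟨segment_subset_convexHull hu hv (crossing_mem_segment hlu hlv),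
        (apply_crossing (hlu.trans_lt hlv).ne).le⟩

end Crossing

section Polyhedra

variable {E F : Type*} [AddCommGroup E] [Module ℝ E] [AddCommGroup F] [Module ℝ F]
  {P R : Set E}

theorem isPolyhedron_convexHull {s : Set E} (hs : s.Finite) : IsPolyhedron (convexHull ℝ s) :=
  ⟨{hs.toFinset}, by simp⟩

theorem IsPolyhedron.union (hP : IsPolyhedron P) (hR : IsPolyhedron R) :
    IsPolyhedron (P ∪ R) := by
  classical
  obtain ⟨A, rfl⟩ := hP
  obtain ⟨B, rfl⟩ := hR
  exact ⟨A ∪ B, (Finset.set_biUnion_union A B _).symm⟩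

theorem IsPolyhedron.biUnion {ι : Type*} (s : Finset ι) {P : ι → Set E}
    (hP : ∀ i ∈ s, IsPolyhedron (P i)) : IsPolyhedron (⋃ i ∈ s, P i) := by
  classical
  induction s using Finset.induction_on with
  | empty => exact ⟨∅, by simp⟩
  | insert i s _ ih =>
    rw [Finset.set_biUnion_insert]
    exact (hP i (Finset.mem_insert_self i s)).union
      (ih fun j hj => hP j (Finset.mem_insert_of_mem hj))

theorem IsPolyhedron.image (hP : IsPolyhedron P) (g : E →ᵃ[ℝ] F) : IsPolyhedron (g '' P) := by
  obtain ⟨A, rfl⟩ := hP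
  rw [Set.image_iUnion₂]
  refine .biUnion A fun s _ => ?_
  rw [AffineMap.image_convexHull]
  exact isPolyhedron_convexHull (s.finite_toSet.image g)

theorem IsPolyhedron.inter_halfspace (hP : IsPolyhedron P) (l : E →ᵃ[ℝ] ℝ) :
    IsPolyhedron (P ∩ {x | l x ≤ 0}) := by
  obtain ⟨A, rfl⟩ := hP
  rw [Set.iUnion₂_inter]
  refine .biUnion A fun s _ => ?_
  have hs : (s : Set E).Finite := s.finite_toSet
  rw [convexHull_inter_halfspace]
  exact isPolyhedron_convexHull ((hs.sep _).union (.image2 _ (hs.sep _) (hs.sep _)))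

/-- Possibly unbounded polyhedra: the sets obtained from closed half-spaces by finite unions and
intersections. -/
inductive IsPolyhedral : Set E → Prop
  | halfspace (l : E →ᵃ[ℝ] ℝ) : IsPolyhedral {x | l x ≤ 0}
  | inter {S T : Set E} : IsPolyhedral S → IsPolyhedral T → IsPolyhedral (S ∩ T)
  | union {S T : Set E} : IsPolyhedral S → IsPolyhedral T → IsPolyhedral (S ∪ T)

theorem IsPolyhedral.preimage {S : Set F} (hS : IsPolyhedral S) (g : E →ᵃ[ℝ] F) :
    IsPolyhedral (g ⁻¹' S) := by
  induction hS with
  | halfspace l => exact .halfspace (l.comp g)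
  | inter _ _ ihS ihT => exact .inter ihS ihT
  | union _ _ ihS ihT => exact .union ihS ihT

theorem IsPolyhedral.image {S : Set E} (hS : IsPolyhedral S) (g : E ≃ᵃ[ℝ] F) :
    IsPolyhedral (g '' S) := by
  rw [← AffineEquiv.coe_toEquiv, Equiv.image_eq_preimage_symm]
  exact hS.preimage g.symm.toAffineMap

theorem IsPolyhedron.inter_isPolyhedral {S : Set E} (hP : IsPolyhedron P) (hS : IsPolyhedral S) :
    IsPolyhedron (P ∩ S) := by
  induction hS generalizing P with
  | halfspace l => exact hP.inter_halfspace l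
  | inter _ _ ihS ihT =>
    rw [← Set.inter_assoc]
    exact ihT (ihS hP)
  | union _ _ ihS ihT =>
    rw [Set.inter_union_distrib_left]
    exact (ihS hP).union (ihT hP)

end Polyhedra

theorem isPolyhedral_le_coord {ι : Type*} (i : ι) (c : ℝ) : IsPolyhedral {v : ι → ℝ | v i ≤ c} := by
  simpa using IsPolyhedral.halfspace
    ((LinearMap.proj i : (ι → ℝ) →ₗ[ℝ] ℝ).toAffineMap - AffineMap.const ℝ (ι → ℝ) c)

theorem isPolyhedral_coord_ge {ι : Type*} (i : ι) (c : ℝ) : IsPolyhedral {v : ι → ℝ | c ≤ v i} := by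
  simpa using IsPolyhedral.halfspace
    (AffineMap.const ℝ (ι → ℝ) c - (LinearMap.proj i : (ι → ℝ) →ₗ[ℝ] ℝ).toAffineMap)

theorem isPolyhedral_abs_coord_le {ι : Type*} (i : ι) (c : ℝ) :
    IsPolyhedral {v : ι → ℝ | |v i| ≤ c} := by
  simpa only [abs_le, Set.ofPred_and] using
    (isPolyhedral_coord_ge i (-c)).inter (isPolyhedral_le_coord i c)

theorem isPolyhedral_le_abs_coord {ι : Type*} (i : ι) (c : ℝ) :
    IsPolyhedral {v : ι → ℝ | c ≤ |v i|} := by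
  simpa only [le_abs', Set.ofPred_or] using
    (isPolyhedral_le_coord i (-c)).union (isPolyhedral_coord_ge i c)

theorem isPolyhedral_solidTorus : IsPolyhedral solidTorus := by
  simpa only [solidTorus, Set.ofPred_and, Set.ofPred_or] using
    (isPolyhedral_abs_coord_le 0 3).inter ((isPolyhedral_abs_coord_le 1 3).inter
      ((isPolyhedral_abs_coord_le 2 1).inter
        ((isPolyhedral_le_abs_coord 0 1).union (isPolyhedral_le_abs_coord 1 1))))

/-! ### Null-homotopic inclusions -/

theorem nullhomotopic_inclusion {Y : Type*} [TopologicalSpace Y] {A C P : Set Y}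
    [ContractibleSpace C] (hAC : A ⊆ C) (hCP : C ⊆ P) :
    (ContinuousMap.inclusion (hAC.trans hCP)).Nullhomotopic :=
  ((id_nullhomotopic C).comp_right (ContinuousMap.inclusion hCP)).comp_left
    (ContinuousMap.inclusion hAC)

theorem contractibleSpace_image {E Y : Type*} [AddCommGroup E] [Module ℝ E] [TopologicalSpace E]
    [IsTopologicalAddGroup E] [ContinuousSMul ℝ E] [TopologicalSpace Y] [T2Space Y] {B : Set E}
    {f : E → Y} (hB : Convex ℝ B) (hne : B.Nonempty) (hc : IsCompact B) (hf : ContinuousOn f B)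
    (hinj : Set.InjOn f B) : ContractibleSpace (f '' B) := by
  have : CompactSpace B := isCompact_iff_compactSpace.1 hc
  have : ContractibleSpace B := hB.contractibleSpace hne
  have hemb : Topology.IsClosedEmbedding (B.domRestrict f) :=
    hf.domRestrict.isClosedEmbedding (Set.injOn_iff_injective.1 hinj)
  rw [← Set.range_domRestrict]
  exact hemb.isEmbedding.toHomeomorph.symm.contractibleSpace

/-! ### Polygonal paths -/

section PolyPath

variable {v w : Fin 3 → ℝ} {l l' : List (Fin 3 → ℝ)} {t : ℝ}

theorem polyPath_cons_zero (v : Fin 3 → ℝ) (l : List (Fin 3 → ℝ)) : polyPath (v :: l) 0 = v := by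
  cases l <;> simp [polyPath]

theorem polyPath_cons_cons_of_le (ht : t ≤ 1) :
    polyPath (v :: w :: l) t = AffineMap.lineMap v w t := by
  simp [polyPath, ht]

theorem polyPath_cons_of_ge (hl : l ≠ []) (ht : 1 ≤ t) :
    polyPath (v :: l) t = polyPath l (t - 1) := by
  obtain ⟨w, l, rfl⟩ := List.exists_cons_of_ne_nil hl
  rcases ht.eq_or_lt with rfl | ht
  · rw [polyPath_cons_cons_of_le le_rfl, sub_self, polyPath_cons_zero, AffineMap.lineMap_apply_one]
  · simp [polyPath, ht.not_ge]

theorem polyPath_append_left (hl : l ≠ []) (h0 : 0 ≤ t) (ht : t ≤ l.length - 1) :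
    polyPath (l ++ l') t = polyPath l t := by
  induction l generalizing t with
  | nil => exact absurd rfl hl
  | cons v l ih =>
    cases l with
    | nil =>
      obtain rfl : t = 0 := le_antisymm (by simpa using ht) h0
      rw [List.cons_append, polyPath_cons_zero, polyPath_cons_zero]
    | cons w l =>
      rcases le_total t 1 with h | h
      · rw [List.cons_append, List.cons_append, polyPath_cons_cons_of_le h,
          polyPath_cons_cons_of_le h]
      · rw [List.length_cons, Nat.cast_succ, add_sub_cancel_right] at ht
        rw [List.cons_append, polyPath_cons_of_ge (by simp) h, polyPath_cons_of_ge (by simp) h,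
          ih (by simp) (sub_nonneg.2 h) (sub_le_sub_right ht 1)]

theorem polyPath_append_right (hl' : l' ≠ []) (ht : l.length ≤ t) :
    polyPath (l ++ l') t = polyPath l' (t - l.length) := by
  induction l generalizing t with
  | nil => simp
  | cons v l ih =>
    rw [List.length_cons, Nat.cast_succ] at ht ⊢
    rw [List.cons_append, polyPath_cons_of_ge (by simp [hl'])
      (by linarith [l.length.cast_nonneg (α := ℝ)]), ih (by linarith)]
    congr 1
    ring

theorem polyPath_append_junction (hl : l ≠ []) (hl' : l' ≠ []) (h0 : l.length - 1 ≤ t)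
    (ht : t ≤ l.length) : polyPath (l ++ l') t =
      AffineMap.lineMap (l.getLast hl) (l'.head hl') (t - (l.length - 1)) := by
  obtain ⟨w, l', rfl⟩ := List.exists_cons_of_ne_nil hl'
  have hlen : (l.dropLast.length : ℝ) = l.length - 1 := by
    rw [List.length_dropLast, Nat.cast_pred (List.length_pos_of_ne_nil hl)]
  conv_lhs => rw [← List.dropLast_append_getLast hl, List.append_assoc]
  rw [polyPath_append_right (by simp) (by rw [hlen]; exact h0), hlen, List.singleton_append,
    polyPath_cons_cons_of_le (by linarith), List.head_cons]

theorem polyPath_map (g : (Fin 3 → ℝ) →ᵃ[ℝ] (Fin 3 → ℝ)) (hl : l ≠ []) (t : ℝ) :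
    polyPath (l.map g) t = g (polyPath l t) := by
  induction l generalizing t with
  | nil => exact absurd rfl hl
  | cons v l ih =>
    cases l with
    | nil => rfl
    | cons w l =>
      rcases le_total t 1 with h | h
      · simp only [List.map_cons, polyPath_cons_cons_of_le h, AffineMap.apply_lineMap]
      · rw [List.map_cons, polyPath_cons_of_ge (by simp) h, polyPath_cons_of_ge (by simp) h,
          ih (by simp)]

theorem polyPath_mem {S : Set (Fin 3 → ℝ)} (hl : l.IsChain fun v w => segment ℝ v w ⊆ S)
    (hlen : 2 ≤ l.length) (h0 : 0 ≤ t) (ht : t ≤ l.length - 1) : polyPath l t ∈ S := by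
  induction l generalizing t with
  | nil => simp at hlen
  | cons v l ih =>
    obtain ⟨w, l, rfl⟩ := List.exists_cons_of_ne_nil (l := l) (by rintro rfl; simp at hlen)
    rw [List.isChain_cons_cons] at hl
    rcases le_total t 1 with h | h
    · rw [polyPath_cons_cons_of_le h]
      refine hl.1 ?_
      rw [segment_eq_image_lineMap]
      exact ⟨t, ⟨h0, h⟩, rfl⟩
    · rw [List.length_cons, Nat.cast_succ, add_sub_cancel_right] at ht
      rw [polyPath_cons_of_ge (by simp) h]
      cases l with
      | nil =>
        obtain rfl : t = 1 := le_antisymm (by simpa using ht) h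
        exact hl.1 (by simpa [polyPath] using right_mem_segment ℝ v w)
      | cons x l => exact ih hl.2 (by simp) (sub_nonneg.2 h) (sub_le_sub_right ht 1)

end PolyPath

/-! ### The solid torus and its embedding in itself -/

section SolidTorus

variable {v w : Fin 3 → ℝ}

/-- The map `bing` as an affine automorphism of `ℝ³`. -/
noncomputable def bingEquiv : (Fin 3 → ℝ) ≃ᵃ[ℝ] (Fin 3 → ℝ) where
  toFun := bing
  invFun w := ![6 * w 1, 6 * w 2, 6 * (w 0 - 2)]
  left_inv v := by ext i; fin_cases i <;> simp [bing] <;> ring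
  right_inv v := by ext i; fin_cases i <;> simp [bing]
  linear :=
    { toFun := fun v => ![v 2 / 6, v 0 / 6, v 1 / 6]
      invFun := fun w => ![6 * w 1, 6 * w 2, 6 * w 0]
      map_add' := fun v w => by ext i; fin_cases i <;> simp <;> ring
      map_smul' := fun c v => by ext i; fin_cases i <;> simp <;> ring
      left_inv := fun v => by ext i; fin_cases i <;> simp <;> ring
      right_inv := fun v => by ext i; fin_cases i <;> simp }
  map_vadd' v w := by ext i; fin_cases i <;> simp [bing] <;> ring

theorem bing_injective : Function.Injective bing := bingEquiv.injective

theorem continuous_bing : Continuous bing := bingEquiv.toAffineMap.continuous_of_finiteDimensional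

/-- A convex box in the solid torus that contains the image of `bing`. -/
def bingBox : Set (Fin 3 → ℝ) := Set.Icc ![11 / 6, -1 / 2, -1 / 2] ![13 / 6, 1 / 2, 1 / 2]

theorem mem_bingBox :
    v ∈ bingBox ↔ v 0 ∈ Set.Icc (11 / 6) (13 / 6) ∧ |v 1| ≤ 1 / 2 ∧ |v 2| ≤ 1 / 2 := by
  simp only [bingBox, ← Set.pi_univ_Icc, Set.mem_univ_pi, Fin.forall_fin_succ, abs_le, neg_div]
  simp

theorem image_bing_solidTorus :
    bing '' solidTorus = bingBox \ {v | |v 1| < 1 / 6 ∧ |v 2| < 1 / 6} := by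
  ext v
  obtain ⟨u, rfl⟩ := bingEquiv.surjective v
  change bing u ∈ _ ↔ bing u ∈ _
  have hx : 2 + u 2 / 6 ∈ Set.Icc (11 / 6) (13 / 6) ↔ |u 2| ≤ 1 := by
    rw [abs_le, Set.mem_Icc]
    constructor <;> rintro ⟨h, h'⟩ <;> constructor <;> linarith
  have hle (x : ℝ) : |x / 6| ≤ 1 / 2 ↔ |x| ≤ 3 := by
    rw [abs_div, abs_of_pos (by norm_num : (0 : ℝ) < 6)]
    constructor <;> intro h <;> linarith
  have hlt (x : ℝ) : |x / 6| < 1 / 6 ↔ |x| < 1 := by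
    rw [abs_div, abs_of_pos (by norm_num : (0 : ℝ) < 6)]
    constructor <;> intro h <;> linarith
  rw [bing_injective.mem_set_image, Set.mem_sdiff, mem_bingBox]
  simp only [bing, solidTorus, Set.mem_ofPred_eq, Matrix.cons_val, hx, hle, hlt, not_and_or, not_lt]
  tauto

theorem bingBox_subset_solidTorus : bingBox ⊆ solidTorus := by
  intro v hv
  obtain ⟨⟨h0, h0'⟩, h1, h2⟩ := mem_bingBox.1 hv
  exact ⟨abs_le.2 ⟨by linarith, by linarith⟩, h1.trans (by norm_num), h2.trans (by norm_num),
    .inl (le_abs.2 (.inl (by linarith)))⟩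

theorem image_bing_subset_bingBox : bing '' solidTorus ⊆ bingBox :=
  image_bing_solidTorus.subset.trans Set.sdiff_subset

theorem bing_mapsTo : Set.MapsTo bing solidTorus solidTorus :=
  Set.mapsTo_iff_image_subset.2 (image_bing_subset_bingBox.trans bingBox_subset_solidTorus)

theorem apply_mem_of_mem_segment {ι : Type*} {v w x : ι → ℝ} {C : Set ℝ} (hC : Convex ℝ C)
    {i : ι} (hv : v i ∈ C) (hw : w i ∈ C) (hx : x ∈ segment ℝ v w) : x i ∈ C :=
  (hC.linear_preimage (LinearMap.proj i : (ι → ℝ) →ₗ[ℝ] ℝ)).segment_subset hv hw hx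

theorem segment_subset_solidTorus (h : (|v 0| ≤ 3 ∧ |v 1| ≤ 3 ∧ |v 2| ≤ 1) ∧
    (|w 0| ≤ 3 ∧ |w 1| ≤ 3 ∧ |w 2| ≤ 1) ∧ ((v 0 ≤ -1 ∧ w 0 ≤ -1) ∨ (1 ≤ v 0 ∧ 1 ≤ w 0) ∨
      (v 1 ≤ -1 ∧ w 1 ≤ -1) ∨ (1 ≤ v 1 ∧ 1 ≤ w 1))) : segment ℝ v w ⊆ solidTorus := by
  obtain ⟨hv, hw, h⟩ := h
  simp only [abs_le] at hv hw
  intro x hx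
  refine ⟨abs_le.2 (apply_mem_of_mem_segment (convex_Icc (-3) 3) hv.1 hw.1 hx),
    abs_le.2 (apply_mem_of_mem_segment (convex_Icc (-3) 3) hv.2.1 hw.2.1 hx),
    abs_le.2 (apply_mem_of_mem_segment (convex_Icc (-1) 1) hv.2.2 hw.2.2 hx), ?_⟩
  rw [le_abs', le_abs', or_assoc]
  rcases h with h | h | h | h
  · exact .inl (apply_mem_of_mem_segment (convex_Iic (-1)) h.1 h.2 hx)
  · exact .inr (.inl (apply_mem_of_mem_segment (convex_Ici 1) h.1 h.2 hx))
  · exact .inr (.inr (.inl (apply_mem_of_mem_segment (convex_Iic (-1)) h.1 h.2 hx)))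
  · exact .inr (.inr (.inr (apply_mem_of_mem_segment (convex_Ici 1) h.1 h.2 hx)))

theorem notMem_image_bing (h : v 0 < 11 / 6 ∨ 13 / 6 < v 0 ∨ v 1 < -1 / 2 ∨ 1 / 2 < v 1 ∨
    (|v 1| < 1 / 6 ∧ |v 2| < 1 / 6)) : v ∉ bing '' solidTorus := by
  rw [image_bing_solidTorus]
  rintro ⟨hv, hole⟩
  rw [mem_bingBox, Set.mem_Icc, abs_le] at hv
  rcases h with h | h | h | h | h
  · exact h.not_ge hv.1.1
  · exact h.not_ge hv.1.2
  · linarith [hv.2.1.1]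
  · linarith [hv.2.1.2]
  · exact hole h

theorem segment_subset_compl_image_bing (h : (v 0 < 11 / 6 ∧ w 0 < 11 / 6) ∨
    (13 / 6 < v 0 ∧ 13 / 6 < w 0) ∨ (v 1 < -1 / 2 ∧ w 1 < -1 / 2) ∨ (1 / 2 < v 1 ∧ 1 / 2 < w 1) ∨
    ((|v 1| < 1 / 6 ∧ |v 2| < 1 / 6) ∧ |w 1| < 1 / 6 ∧ |w 2| < 1 / 6)) :
    segment ℝ v w ⊆ (bing '' solidTorus)ᶜ := by
  intro x hx
  apply notMem_image_bing
  rcases h with h | h | h | h | ⟨hv, hw⟩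
  · exact .inl (apply_mem_of_mem_segment (convex_Iio _) h.1 h.2 hx)
  · exact .inr (.inl (apply_mem_of_mem_segment (convex_Ioi _) h.1 h.2 hx))
  · exact .inr (.inr (.inl (apply_mem_of_mem_segment (convex_Iio _) h.1 h.2 hx)))
  · exact .inr (.inr (.inr (.inl (apply_mem_of_mem_segment (convex_Ioi _) h.1 h.2 hx))))
  · rw [abs_lt, abs_lt] at hv hw
    refine .inr (.inr (.inr (.inr ?_)))
    exact ⟨abs_lt.2 (apply_mem_of_mem_segment (convex_Ioo _ _) hv.1 hw.1 hx),
      abs_lt.2 (apply_mem_of_mem_segment (convex_Ioo _ _) hv.2 hw.2 hx)⟩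

theorem image_iterate_bing_succ (n : ℕ) (S : Set (Fin 3 → ℝ)) :
    bing^[n + 1] '' S = bing '' (bing^[n] '' S) := by
  rw [Function.iterate_succ', Set.image_comp]

theorem isPolyhedral_image_iterate_bing (n : ℕ) : IsPolyhedral (bing^[n] '' solidTorus) := by
  induction n with
  | zero => simpa using isPolyhedral_solidTorus
  | succ n ih => exact image_iterate_bing_succ n _ ▸ ih.image bingEquiv

theorem convex_image_iterate_bing (n : ℕ) {B : Set (Fin 3 → ℝ)} (hB : Convex ℝ B) :
    Convex ℝ (bing^[n] '' B) := by
  induction n with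
  | zero => simpa using hB
  | succ n ih => exact image_iterate_bing_succ n _ ▸ ih.affine_image bingEquiv.toAffineMap

theorem image_iterate_bing_subset (n : ℕ) : bing^[n] '' solidTorus ⊆ solidTorus :=
  (bing_mapsTo.iterate n).image_subset

theorem antitone_image_iterate_bing : Antitone fun n => bing^[n] '' solidTorus :=
  antitone_nat_of_succ_le fun n => by
    rw [Function.iterate_succ, Set.image_comp]
    exact Set.image_mono bing_mapsTo.image_subset

end SolidTorus

/-! ### The Milnor arcs -/

/-- The vertices of `milnorArc (k + 1)` that precede the copy of `milnorArc k`. -/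
noncomputable def milnorPrefix : List (Fin 3 → ℝ) :=
  [bandA, ![-2, 1 / 2, 0], ![-2, 2, 0], ![5 / 2, 2, 0], ![5 / 2, 1 / 12, 0], ![3 / 2, 1 / 12, 0],
    ![3 / 2, 3 / 2, 0], ![-3 / 2, 3 / 2, 0], ![-3 / 2, -3 / 2, 0], ![3 / 2, -3 / 2, 0],
    ![3 / 2, -1 / 12, 0], ![5 / 2, -1 / 12, 0], ![5 / 2, -2, 0], ![25 / 12, -2, 0]]

/-- The vertices of `milnorArc (k + 1)` that follow the copy of `milnorArc k`. -/
noncomputable def milnorSuffix : List (Fin 3 → ℝ) :=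
  [![23 / 12, -2, 0], ![-2, -2, 0], ![-2, -1 / 2, 0], bandB]

theorem milnorArc_succ (k : ℕ) :
    milnorArc (k + 1) = milnorPrefix ++ ((milnorArc k).map bing ++ milnorSuffix) := by
  simp [milnorArc, milnorChain, milnorPrefix, milnorSuffix]

theorem milnorArc_ne_nil (k : ℕ) : milnorArc k ≠ [] := by simp [milnorArc]

theorem length_milnorArc (k : ℕ) : ((milnorArc k).length : ℝ) = milnorEdges k + 1 := by
  rw [milnorEdges, sub_add_cancel]

theorem two_le_length_milnorArc (k : ℕ) : 2 ≤ (milnorArc k).length := by simp [milnorArc]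

theorem milnorEdges_pos (k : ℕ) : 0 < milnorEdges k := by
  have : (2 : ℝ) ≤ (milnorArc k).length := by exact_mod_cast two_le_length_milnorArc k
  rw [milnorEdges]
  linarith

theorem milnorEdges_succ (k : ℕ) : milnorEdges (k + 1) = milnorEdges k + 18 := by
  simp only [milnorEdges, milnorArc_succ, List.length_append, List.length_map, milnorPrefix,
    milnorSuffix, List.length_cons, List.length_nil]
  push_cast
  ring

theorem milnorEdges_add (n j : ℕ) : milnorEdges (n + j) = milnorEdges j + 18 * n := by
  induction n with
  | zero => simp
  | succ n ih =>
    rw [Nat.add_right_comm, milnorEdges_succ, ih]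
    push_cast
    ring

theorem Icc_milnorEdges_subset (n j : ℕ) :
    Set.Icc (14 * n : ℝ) (14 * n + milnorEdges j) ⊆ Set.Icc 0 (milnorEdges (n + j)) := by
  rw [milnorEdges_add]
  exact Set.Icc_subset_Icc (by positivity) (by linarith [n.cast_nonneg (α := ℝ)])

section Parametrization

variable {k : ℕ} {t : ℝ}

theorem polyPath_milnorArc_succ_initial (h0 : 0 ≤ t) (ht : t ≤ 13) :
    polyPath (milnorArc (k + 1)) t = polyPath milnorPrefix t := by
  rw [milnorArc_succ]
  exact polyPath_append_left (by simp [milnorPrefix]) h0 (by norm_num [milnorPrefix, ht])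

theorem polyPath_milnorArc_succ_entrance (h0 : 13 ≤ t) (ht : t ≤ 14) :
    polyPath (milnorArc (k + 1)) t =
      AffineMap.lineMap ![25 / 12, -2, 0] (bing bandA) (t - 13) := by
  rw [milnorArc_succ, polyPath_append_junction (by simp [milnorPrefix]) (by simp [milnorSuffix])
    (by norm_num [milnorPrefix, h0]) (by norm_num [milnorPrefix, ht])]
  norm_num [milnorPrefix, milnorArc]

theorem polyPath_milnorArc_succ_core (h0 : 14 ≤ t) (ht : t ≤ 14 + milnorEdges k) :
    polyPath (milnorArc (k + 1)) t = bing (polyPath (milnorArc k) (t - 14)) := by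
  have hlen : (milnorPrefix.length : ℝ) = 14 := by norm_num [milnorPrefix]
  have hmap := polyPath_map bingEquiv.toAffineMap (milnorArc_ne_nil k) (t - 14)
  rw [milnorArc_succ, polyPath_append_right (by simp [milnorSuffix]) (hlen.trans_le h0), hlen,
    polyPath_append_left (by simp [milnorArc]) (sub_nonneg.2 h0)]
  · exact hmap
  · rw [List.length_map, ← milnorEdges]
    linarith

theorem polyPath_milnorArc_succ_exit (h0 : 14 + milnorEdges k ≤ t) (ht : t ≤ 15 + milnorEdges k) :
    polyPath (milnorArc (k + 1)) t =
      AffineMap.lineMap (bing bandB) ![23 / 12, -2, 0] (t - (14 + milnorEdges k)) := by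
  have hlen : (milnorPrefix.length : ℝ) = 14 := by norm_num [milnorPrefix]
  have he := milnorEdges_pos k
  rw [milnorArc_succ, polyPath_append_right (by simp [milnorSuffix]) (by linarith), hlen,
    polyPath_append_junction (by simp [milnorArc]) (by simp [milnorSuffix]) _ _, List.length_map,
    ← milnorEdges, sub_sub]
  · simp [milnorArc, milnorSuffix]
  · rw [List.length_map, ← milnorEdges]
    linarith
  · rw [List.length_map, length_milnorArc]
    linarith

theorem polyPath_milnorArc_succ_final (h0 : 15 + milnorEdges k ≤ t) :
    polyPath (milnorArc (k + 1)) t = polyPath milnorSuffix (t - (15 + milnorEdges k)) := by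
  have hlen : ((milnorPrefix ++ (milnorArc k).map bing).length : ℝ) = 15 + milnorEdges k := by
    rw [List.length_append, List.length_map, Nat.cast_add, length_milnorArc]
    norm_num [milnorPrefix]
    ring
  rw [milnorArc_succ, ← List.append_assoc, polyPath_append_right (by simp [milnorSuffix])
    (hlen.trans_le h0), hlen]

end Parametrization

theorem isChain_milnorArc (k : ℕ) :
    (milnorArc k).IsChain fun v w => segment ℝ v w ⊆ solidTorus := by
  induction k with
  | zero =>
    refine List.IsChain.imp (fun v w => segment_subset_solidTorus) ?_
    norm_num [milnorArc, milnorChain, bandA, bandB, abs_le, Matrix.cons_val_two]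
  | succ k ih =>
    rw [milnorArc_succ, List.isChain_append, List.isChain_append, List.isChain_map]
    refine ⟨List.IsChain.imp (fun v w => segment_subset_solidTorus) ?_,
      ⟨ih.imp fun v w h => ?_, List.IsChain.imp (fun v w => segment_subset_solidTorus) ?_, ?_⟩, ?_⟩
    · norm_num [milnorPrefix, bandA, abs_le, Matrix.cons_val_two]
    · exact (image_segment ℝ bingEquiv.toAffineMap v w).symm.subset.trans
        ((Set.image_mono h).trans bing_mapsTo.image_subset)
    · norm_num [milnorSuffix, bandB, abs_le, Matrix.cons_val_two]
    · have hlast : (milnorArc k).getLast? = some bandB := by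
        rw [milnorArc, ← List.cons_append, List.getLast?_concat]
      simp only [List.getLast?_map, hlast, Option.map_some, milnorSuffix, List.head?_cons,
        Option.mem_some_iff, forall_eq']
      refine segment_subset_solidTorus ?_
      norm_num [bing, bandB, abs_le, Matrix.cons_val_two]
    · simp only [milnorPrefix, List.getLast?_cons_cons, List.getLast?_singleton, milnorArc,
        List.map_cons, List.cons_append, List.head?_cons, Option.mem_some_iff, forall_eq']
      refine segment_subset_solidTorus ?_
      norm_num [bing, bandA, abs_le, Matrix.cons_val_two]

theorem isChain_milnorPrefix :
    milnorPrefix.IsChain fun v w => segment ℝ v w ⊆ (bing '' solidTorus)ᶜ := by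
  refine List.IsChain.imp (fun v w => segment_subset_compl_image_bing) ?_
  norm_num [milnorPrefix, bandA, abs_lt, Matrix.cons_val_two]

theorem isChain_milnorSuffix :
    milnorSuffix.IsChain fun v w => segment ℝ v w ⊆ (bing '' solidTorus)ᶜ := by
  refine List.IsChain.imp (fun v w => segment_subset_compl_image_bing) ?_
  norm_num [milnorSuffix, bandB, abs_lt, Matrix.cons_val_two]

theorem polyPath_milnorArc_mem {k : ℕ} {t : ℝ} (ht : t ∈ Set.Icc 0 (milnorEdges k)) :
    polyPath (milnorArc k) t ∈ solidTorus :=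
  polyPath_mem (isChain_milnorArc k) (two_le_length_milnorArc k) ht.1 ht.2

theorem polyPath_milnorArc_succ_notMem {k : ℕ} {t : ℝ}
    (ht : t ∈ Set.Icc 0 (milnorEdges (k + 1))) (h : t - 14 ∉ Set.Icc 0 (milnorEdges k)) :
    polyPath (milnorArc (k + 1)) t ∉ bing '' solidTorus := by
  rw [milnorEdges_succ] at ht
  have he := milnorEdges_pos k
  rw [Set.mem_Icc, not_and_or, not_le, not_le] at h
  rcases h with h | h
  · rcases le_total t 13 with h13 | h13
    · rw [polyPath_milnorArc_succ_initial ht.1 h13]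
      exact polyPath_mem isChain_milnorPrefix (by simp [milnorPrefix]) ht.1
        (by norm_num [milnorPrefix, h13])
    · rw [polyPath_milnorArc_succ_entrance h13 (by linarith)]
      have hy : (AffineMap.lineMap ![25 / 12, -2, 0] (bing bandA) (t - 13) : Fin 3 → ℝ) 1 =
          3 / 2 * (t - 13) - 2 := by
        norm_num [AffineMap.lineMap_apply, bing, bandA]
        ring
      exact notMem_image_bing (.inr (.inr (.inl (by linarith))))
  · rcases le_total t (15 + milnorEdges k) with h15 | h15
    · rw [polyPath_milnorArc_succ_exit (by linarith) h15]
      have hy : (AffineMap.lineMap (bing bandB) ![23 / 12, -2, 0]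
          (t - (14 + milnorEdges k)) : Fin 3 → ℝ) 1 =
            -1 / 2 - 3 / 2 * (t - (14 + milnorEdges k)) := by
        norm_num [AffineMap.lineMap_apply, bing, bandB]
        ring
      exact notMem_image_bing (.inr (.inr (.inl (by linarith))))
    · rw [polyPath_milnorArc_succ_final h15]
      exact polyPath_mem isChain_milnorSuffix (by simp [milnorSuffix]) (by linarith)
        (by norm_num [milnorSuffix]; linarith [ht.2])

theorem polyPath_milnorArc_succ_mem_iff {k : ℕ} {t : ℝ} {S : Set (Fin 3 → ℝ)}
    (ht : t ∈ Set.Icc 0 (milnorEdges (k + 1))) (hS : S ⊆ solidTorus) :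
    polyPath (milnorArc (k + 1)) t ∈ bing '' S ↔
      t - 14 ∈ Set.Icc 0 (milnorEdges k) ∧ polyPath (milnorArc k) (t - 14) ∈ S := by
  by_cases h : t - 14 ∈ Set.Icc 0 (milnorEdges k)
  · rw [polyPath_milnorArc_succ_core (sub_nonneg.1 h.1) (sub_le_iff_le_add'.1 h.2),
      bing_injective.mem_set_image]
    simp only [h, true_and]
  · simp only [h, false_and, iff_false]
    exact fun hmem => polyPath_milnorArc_succ_notMem ht h (Set.image_mono hS hmem)

theorem polyPath_milnorArc_add_mem_iff (n j : ℕ) {t : ℝ}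
    (ht : t ∈ Set.Icc 0 (milnorEdges (n + j))) :
    polyPath (milnorArc (n + j)) t ∈ bing^[n] '' solidTorus ↔
      t ∈ Set.Icc (14 * n : ℝ) (14 * n + milnorEdges j) := by
  induction n generalizing t with
  | zero =>
    rw [zero_add] at ht ⊢
    simpa [polyPath_milnorArc_mem ht] using ht
  | succ n ih =>
    rw [Nat.add_right_comm] at ht ⊢
    rw [image_iterate_bing_succ,
      polyPath_milnorArc_succ_mem_iff ht (image_iterate_bing_subset n),
      and_congr_right fun h => ih h, and_iff_right_of_imp fun h => Icc_milnorEdges_subset n j h,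
      Set.mem_Icc, Set.mem_Icc, Nat.cast_succ]
    constructor <;> rintro ⟨h, h'⟩ <;> constructor <;> linarith

/-! ### Elementary moves are allowed in quasi-isotopies -/

theorem IsPLOn.isPolyhedron_image {E : Type*} [AddCommGroup E] [Module ℝ E] [TopologicalSpace E]
    {f : E → S3} {P S : Set E} (hf : IsPLOn f P) (hS : IsPolyhedral S) (hSP : S ⊆ P) :
    IsPolyhedron (Subtype.val '' (f '' S)) := by
  convert (hf.2.inter_isPolyhedral
    (hS.preimage (LinearMap.fst ℝ E (Fin 4 → ℝ)).toAffineMap)).image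
    (LinearMap.snd ℝ E (Fin 4 → ℝ)).toAffineMap using 1
  ext y
  constructor
  · rintro ⟨_, ⟨v, hv, rfl⟩, rfl⟩
    exact ⟨(v, f v), ⟨⟨v, hSP hv, rfl⟩, hv⟩, rfl⟩
  · rintro ⟨_, ⟨⟨v, -, rfl⟩, hv⟩, rfl⟩
    exact ⟨_, ⟨v, hv, rfl⟩, rfl⟩

theorem isArc_image_Icc {κ : ℝ → S1} {a b : ℝ} (hab : a < b) (hc : ContinuousOn κ (Set.Icc a b))
    (hi : Set.InjOn κ (Set.Icc a b)) : IsArc (κ '' Set.Icc a b) := by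
  let h := (iccHomeoI a b hab).symm
  refine ⟨Set.domRestrict (Set.Icc a b) κ ∘ h, hc.domRestrict.comp h.continuous,
    (Set.injOn_iff_injective.1 hi).comp h.injective, ?_⟩
  rw [h.surjective.range_comp, Set.range_domRestrict]

/-- The `n`-th term of the decreasing sequence of solid tori in `τ(solidTorus)`, each embedded in
the preceding one as a neighborhood of a component of the Bing double of its core. The polyhedra
`P_j` of the quasi-embedding are taken from this sequence. -/
def nestedTorus (τ : (Fin 3 → ℝ) → S3) (n : ℕ) : Set S3 := τ '' (bing^[n] '' solidTorus)

section NestedTorus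

variable {τ : (Fin 3 → ℝ) → S3}

theorem antitone_nestedTorus (τ : (Fin 3 → ℝ) → S3) : Antitone (nestedTorus τ) := fun _ _ h =>
  Set.image_mono (antitone_image_iterate_bing h)

theorem nestedTorus_subset (τ : (Fin 3 → ℝ) → S3) (n : ℕ) : nestedTorus τ n ⊆ τ '' solidTorus :=
  Set.image_mono (image_iterate_bing_subset n)

theorem IsPLOn.isPolyhedron_nestedTorus (hτ : IsPLOn τ solidTorus) (n : ℕ) :
    IsPolyhedron (Subtype.val '' nestedTorus τ n) :=
  hτ.isPolyhedron_image (isPolyhedral_image_iterate_bing n) (image_iterate_bing_subset n)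

/-- Consecutive solid tori are separated by a PL ball, the image of `bingBox`. -/
theorem IsPLEmbOn.nullhomotopic_nestedTorus (hτ : IsPLEmbOn τ solidTorus) {n : ℕ} {A : Set S3}
    (hA : A ⊆ nestedTorus τ (n + 1)) :
    ∃ h : A ⊆ nestedTorus τ n, (ContinuousMap.inclusion h).Nullhomotopic := by
  have hball : nestedTorus τ (n + 1) ⊆ τ '' (bing^[n] '' bingBox) := by
    rw [nestedTorus, Function.iterate_succ, Set.image_comp]
    exact Set.image_mono (Set.image_mono image_bing_subset_bingBox)
  have hsub : bing^[n] '' bingBox ⊆ solidTorus :=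
    (Set.image_mono bingBox_subset_solidTorus).trans (image_iterate_bing_subset n)
  have hne : bingBox.Nonempty := ⟨![2, 0, 0], mem_bingBox.2 (by norm_num [Matrix.cons_val_two])⟩
  have : ContractibleSpace (τ '' (bing^[n] '' bingBox)) :=
    contractibleSpace_image (convex_image_iterate_bing n (convex_Icc _ _)) (hne.image _)
      (isCompact_Icc.image (continuous_bing.iterate n)) (hτ.1.1.mono hsub) (hτ.2.mono hsub)
  exact ⟨_, nullhomotopic_inclusion (hA.trans hball)
    (Set.image_mono (Set.image_mono bingBox_subset_solidTorus))⟩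

end NestedTorus

/-- The map `f : mS¹ → S³` meets the solid torus `τ(solidTorus)` in the singular `k`-th Milnor arc,
which lies in the component `i` and is parametrized by the arc `κ` of the circle. -/
structure MeetsInMilnorArc {m : ℕ} (k : ℕ) (f : Fin m → S1 → S3) (i : Fin m)
    (τ : (Fin 3 → ℝ) → S3) (κ : ℝ → S1) : Prop where
  isPLEmbOn : IsPLEmbOn τ solidTorus
  continuousOn : ContinuousOn κ (Set.Icc 0 (milnorEdges k))
  injOn : Set.InjOn κ (Set.Icc 0 (milnorEdges k))
  notMem_of_ne : ∀ c, c ≠ i → ∀ θ, f c θ ∉ τ '' solidTorus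
  preimage_subset : f i ⁻¹' (τ '' solidTorus) ⊆ κ '' Set.Icc 0 (milnorEdges k)
  apply_arc : ∀ t ∈ Set.Icc 0 (milnorEdges k), f i (κ t) = τ (polyPath (milnorArc k) t)

namespace MeetsInMilnorArc

variable {m k n j : ℕ} {f : Fin m → S1 → S3} {i : Fin m} {τ : (Fin 3 → ℝ) → S3} {κ : ℝ → S1}

theorem preimage_nestedTorus (h : MeetsInMilnorArc (n + j) f i τ κ) :
    f i ⁻¹' nestedTorus τ n = κ '' Set.Icc (14 * n : ℝ) (14 * n + milnorEdges j) := by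
  have hmem (t) (ht : t ∈ Set.Icc 0 (milnorEdges (n + j))) :
      f i (κ t) ∈ nestedTorus τ n ↔ t ∈ Set.Icc (14 * n : ℝ) (14 * n + milnorEdges j) := by
    rw [h.apply_arc t ht, nestedTorus, h.isPLEmbOn.2.mem_image_iff (image_iterate_bing_subset n)
      (polyPath_milnorArc_mem ht), polyPath_milnorArc_add_mem_iff n j ht]
  ext θ
  constructor
  · intro hθ
    obtain ⟨t, ht, rfl⟩ := h.preimage_subset (nestedTorus_subset τ n hθ)
    exact ⟨t, (hmem t ht).1 hθ, rfl⟩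
  · rintro ⟨t, ht, rfl⟩
    exact (hmem t (Icc_milnorEdges_subset n j ht)).2 ht

theorem isArc_preimage_nestedTorus (h : MeetsInMilnorArc (n + j) f i τ κ) :
    IsArc (f i ⁻¹' nestedTorus τ n) := by
  have hsub := Icc_milnorEdges_subset n j
  rw [h.preimage_nestedTorus]
  exact isArc_image_Icc (lt_add_of_pos_right _ (milnorEdges_pos j)) (h.continuousOn.mono hsub)
    (h.injOn.mono hsub)

theorem isSingularQuasiEmbedding (h : MeetsInMilnorArc k f i τ κ) {p q : S1}
    (hpq : HasSingleDoublePoint f i p q) (hp : f i p ∈ nestedTorus τ k) :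
    IsSingularQuasiEmbedding k f := by
  let P (j : ℕ) : Set S3 := if j = 0 then {f i p} else nestedTorus τ (k - j)
  have hP (j : ℕ) : P j ⊆ nestedTorus τ (k - j) := by
    by_cases hj : j = 0
    · simpa [P, hj] using hp
    · simp [P, hj]
  refine ⟨i, p, q, hpq, P, fun j => f i ⁻¹' nestedTorus τ (k - j), if_pos rfl, fun j hj => ?_⟩
  have hsucc : k - j = k - (j + 1) + 1 := by omega
  have hPj : P j ⊆ nestedTorus τ (k - (j + 1) + 1) := hsucc ▸ hP j
  rw [show P (j + 1) = nestedTorus τ (k - (j + 1)) from if_neg j.succ_ne_zero]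
  refine ⟨h.isPLEmbOn.1.isPolyhedron_nestedTorus _,
    fun c hc θ hθ => h.notMem_of_ne c hc θ (nestedTorus_subset τ _ hθ), ?_,
    fun _ => Set.preimage_mono (antitone_nestedTorus τ (by omega)), Set.preimage_mono (hP j),
    h.isPLEmbOn.nullhomotopic_nestedTorus (Set.union_subset hPj ?_)⟩
  · have h' : MeetsInMilnorArc (k - j + j) f i τ κ := by rwa [Nat.sub_add_cancel hj.le]
    exact h'.isArc_preimage_nestedTorus
  · rw [← hsucc]
    exact Set.image_preimage_subset _ _

end MeetsInMilnorArc

namespace CrossingChange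

variable {m : ℕ} (X : CrossingChange m) {s t : Set.Icc (-1 : ℝ) 1}

theorem axis_zero_mem_cube (t : Set.Icc (-1 : ℝ) 1) : ![(t : ℝ), 0, 0] ∈ cube :=
  strand_mem_cube (abs_le.2 t.2) (by simp) (by simp)

theorem axis_one_mem_cube (t : Set.Icc (-1 : ℝ) 1) : ![0, (t : ℝ), 0] ∈ cube :=
  strand_mem_cube (by simp) (abs_le.2 t.2) (by simp)

theorem sing_a_inj : X.sing X.i (X.a s) = X.sing X.i (X.a t) ↔ s = t := by
  rw [X.sing_a, X.sing_a, X.e_pl.2.eq_iff (axis_zero_mem_cube s) (axis_zero_mem_cube t)]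
  simp [Subtype.ext_iff]

theorem sing_b_inj : X.sing X.i (X.b s) = X.sing X.i (X.b t) ↔ s = t := by
  rw [X.sing_b, X.sing_b, X.e_pl.2.eq_iff (axis_one_mem_cube s) (axis_one_mem_cube t)]
  simp [Subtype.ext_iff]

theorem sing_a_eq_sing_b_iff :
    X.sing X.i (X.a s) = X.sing X.i (X.b t) ↔ s = ⟨0, by simp⟩ ∧ t = ⟨0, by simp⟩ := by
  rw [X.sing_a, X.sing_b, X.e_pl.2.eq_iff (axis_zero_mem_cube s) (axis_one_mem_cube t)]
  simp [Subtype.ext_iff, eq_comm]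

theorem a_zero_ne_b_zero : X.a ⟨0, by simp⟩ ≠ X.b ⟨0, by simp⟩ := by
  intro h
  have hpos := congrArg (X.pos.toFun X.i) h
  rw [X.pos_a, X.pos_b, X.e_pl.2.eq_iff
    (strand_mem_cube (by simp) (by simp) (by norm_num [abs_le])) (axis_one_mem_cube _)] at hpos
  simp at hpos

theorem sing_mem_image_cube_iff {c : Fin m} {θ : S1} :
    X.sing c θ ∈ X.e '' cube ↔ c = X.i ∧ θ ∈ Set.range X.a ∪ Set.range X.b := by
  refine ⟨fun h => by_contra fun hn => (X.outside c θ hn).1 h, ?_⟩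
  rintro ⟨rfl, ⟨t, rfl⟩ | ⟨t, rfl⟩⟩
  · exact ⟨_, axis_zero_mem_cube t, (X.sing_a t).symm⟩
  · exact ⟨_, axis_one_mem_cube t, (X.sing_b t).symm⟩

theorem hasSingleDoublePoint :
    HasSingleDoublePoint X.sing X.i (X.a ⟨0, by simp⟩) (X.b ⟨0, by simp⟩) := by
  refine ⟨X.sing_pl, X.a_zero_ne_b_zero, X.sing_a_eq_sing_b_iff.2 ⟨rfl, rfl⟩, ?_⟩
  intro c θ c' θ' h
  by_cases hθ : X.sing c θ ∈ X.e '' cube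
  · obtain ⟨rfl, hab'⟩ := X.sing_mem_image_cube_iff.1 (h ▸ hθ)
    obtain ⟨rfl, hab⟩ := X.sing_mem_image_cube_iff.1 hθ
    rcases hab with ⟨s, rfl⟩ | ⟨s, rfl⟩ <;> rcases hab' with ⟨t, rfl⟩ | ⟨t, rfl⟩
    · exact .inl ⟨rfl, congrArg X.a (X.sing_a_inj.1 h)⟩
    · obtain ⟨rfl, rfl⟩ := X.sing_a_eq_sing_b_iff.1 h
      exact .inr ⟨rfl, rfl, .inl ⟨rfl, rfl⟩⟩
    · obtain ⟨rfl, rfl⟩ := X.sing_a_eq_sing_b_iff.1 h.symm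
      exact .inr ⟨rfl, rfl, .inr ⟨rfl, rfl⟩⟩
    · exact .inl ⟨rfl, congrArg X.b (X.sing_b_inj.1 h)⟩
  · have hθ' : X.sing c' θ' ∉ X.e '' cube := h ▸ hθ
    rw [← (X.outside c θ fun hab => hθ (X.sing_mem_image_cube_iff.2 hab)).2.1,
      ← (X.outside c' θ' fun hab => hθ' (X.sing_mem_image_cube_iff.2 hab)).2.1] at h
    exact .inl (Prod.ext_iff.1 (X.pos.inj (a₁ := (c, θ)) (a₂ := (c', θ')) h))

end CrossingChange

namespace IsElementaryMove

variable {m k : ℕ} {L : PLLink m} {X : CrossingChange m}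

theorem exists_meetsInMilnorArc (h : IsElementaryMove k L X) :
    ∃ τ κ, MeetsInMilnorArc k X.sing X.i τ κ ∧
      ∀ u ∈ cube, X.e u = τ (bing^[k] (claspChart u)) := by
  obtain ⟨τ, β, κ, hτ, hdisj, -, -, hβ, hκc, hκi, -, hout, hleft, hmid, hright, he⟩ := h
  have hL (c θ) : L.toFun c θ ∉ τ '' solidTorus := fun hmem =>
    Set.disjoint_left.1 hdisj hmem ⟨c, θ, rfl⟩
  have hsub : Set.Icc 0 (milnorEdges k) ⊆ Set.Icc (-1) (milnorEdges k + 1) :=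
    Set.Icc_subset_Icc (by norm_num) (by norm_num)
  refine ⟨τ, κ, ⟨hτ, hκc.mono hsub, hκi.mono hsub, fun c hc θ => ?_, fun θ hθ => ?_, hmid⟩, he⟩
  · rw [hout c θ fun h => hc h.1]
    exact hL c θ
  · rw [Set.mem_preimage] at hθ
    by_cases hmem : θ ∈ κ '' Set.Icc (-1) (milnorEdges k + 1)
    · obtain ⟨t, ht, rfl⟩ := hmem
      refine ⟨t, ⟨?_, ?_⟩, rfl⟩
      · by_contra! h0
        have ht' : -t ∈ Set.Icc (0 : ℝ) 1 := ⟨by linarith, by linarith [ht.1]⟩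
        rw [← neg_neg t, hleft (-t) ht', (hβ 0 (by simp) (-t) ht').1] at hθ
        linarith
      · by_contra! h1
        have ht' : t - milnorEdges k ∈ Set.Icc (0 : ℝ) 1 := ⟨by linarith, by linarith [ht.2]⟩
        rw [← add_sub_cancel (milnorEdges k) t, hright _ ht', (hβ 1 (by simp) _ ht').1] at hθ
        linarith
    · rw [hout X.i θ fun h => hmem h.2] at hθ
      exact absurd hθ (hL _ _)

theorem isAllowed (h : IsElementaryMove k L X) : X.IsAllowed k := by
  obtain ⟨τ, κ, hκ, he⟩ := h.exists_meetsInMilnorArc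
  refine hκ.isSingularQuasiEmbedding X.hasSingleDoublePoint
    ⟨_, ⟨claspChart ![0, 0, 0], ?_, rfl⟩, ?_⟩
  · norm_num [claspChart, solidTorus, Matrix.cons_val_two, abs_le, le_abs]
  · rw [X.sing_a, he _ (CrossingChange.axis_zero_mem_cube _)]

end IsElementaryMove

end PLTop

theorem theorem3p7_general (m k : ℕ) :
    (∀ Q : PLTop.GroupQuotient m, Q.FunctoriallyInvariant k → Q.FinelyFunctoriallyInvariant k) ∧
      ∀ {G : Type*} [Group G] (M : Set G),
        (EngelSub.mu M k).map (QuotientGroup.mk' (derivedSeries G 2)) =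
          (EngelSub.delta M k).map (QuotientGroup.mk' (derivedSeries G 2)) :=
  ⟨fun _ hQ => ⟨hQ.1, fun _ X hX => hQ.2 X hX.isAllowed⟩,
    fun M => EngelSub.map_mu_eq_map_delta M k⟩

theorem theorem3p7 (m k : ℕ) :
    (∀ Q : PLTop.GroupQuotient m, Q.IsMetabelian →
      Q.FunctoriallyInvariant k → Q.FinelyFunctoriallyInvariant k) ∧
    (∀ (L : PLTop.PLLink m) (x : L.compl),
      (EngelSub.mu (L.meridians x) k).map (QuotientGroup.mk' (derivedSeries (L.grp x) 2)) =
        (EngelSub.delta (L.meridians x) k).map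
          (QuotientGroup.mk' (derivedSeries (L.grp x) 2))) :=
  ⟨fun Q _ => (theorem3p7_general.{0} m k).1 Q,
    fun L x => (theorem3p7_general m k).2 (L.meridians x)⟩
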